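/- Let $(A,\Gamma)$ be a Hopf algebroid (a cogroupoid object in commutative rings, with left and right units $\eta_L,\eta_R\colon A\to\Gamma$, counit, diagonal and conjugation) that is flat, i.e. $\eta_R$ makes $\Gamma$ a flat $A$-module. A $\Gamma$-comodule is a left $A$-module $M$ with a counital and coassociative $A$-linear coaction $M\to\Gamma\otimes_A M$, where $\Gamma$ is a right $A$-module via $\eta_R$ and a left $A$-module via $\eta_L$. Let $B$ be a commutative $A$-algebra that is Landweber exact over $A$, i.e. $B\otimes_A(-)$ takes exact sequences of $\Gamma$-comodules to exact sequences of $B$-modules. Let $\Gamma_B=B\otimes_A\Gamma\otimes_A B$, so that $(B,\Gamma_B)$ is a Hopf algebroid, let $\Phi\colon(A,\Gamma)\to(B,\Gamma_B)$ be the evident map of Hopf algebroids, and let $\Phi_*\colon\Gamma\text{-comod}\to\Gamma_B\text{-comod}$, $\Phi_*M=B\otimes_A M$, be the induced functor. Then: 1. The class $\mathcal T$ of all $\Gamma$-comodules $M$ with $B\otimes_A M=0$ is a hereditary torsion theory, i.e. it is closed under subobjects, quotient objects, extensions and arbitrary direct sums. 2. $\Phi_*$ inverts all maps of $\Gamma$-comodules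 whose kernel and cokernel lie in $\mathcal T$, and the induced functor $$\Phi_*\colon L_{\mathcal T}(\Gamma\text{-comod})\longrightarrow\Gamma_B\text{-comod}$$ is an equivalence of categories, where $L_{\mathcal T}(\Gamma\text{-comod})$ is the localization of $\Gamma\text{-comod}$ obtained by inverting all these maps. 3. $\Phi_*$ has a right adjoint $\Phi^*$, and the counit $\Phi_*\Phi^*\to 1$ of the adjunction is an isomorphism. -/

import Mathlib

open CategoryTheory CategoryTheory.Limits

universe u

/-! ### Tensor products along ring homomorphisms -/

/-- `S ⊗[A] M`, where `S` is an `A`-module through the ring homomorphism `f : A →+* S`. -/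
def BaseChange {A S : Type u} [CommRing A] [CommRing S] (f : A →+* S)
    (M : Type u) [AddCommGroup M] [Module A M] : Type u :=
  letI := f.toAlgebra
  TensorProduct A S M

namespace BaseChange

variable {A S : Type u} [CommRing A] [CommRing S] (f : A →+* S)
  (M : Type u) [AddCommGroup M] [Module A M]

noncomputable instance : AddCommGroup (BaseChange f M) :=
  letI := f.toAlgebra
  (inferInstance : AddCommGroup (TensorProduct A S M))

/-- `S` acts on the left factor. -/
noncomputable instance : Module S (BaseChange f M) :=
  letI := f.toAlgebra
  (inferInstance : Module S (TensorProduct A S M))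

variable {M}

/-- The pure tensor `s ⊗ m`. -/
noncomputable def tmul (s : S) (m : M) : BaseChange f M :=
  letI := f.toAlgebra
  TensorProduct.tmul A s m

theorem tmul_add (s : S) (m n : M) : tmul f s (m + n) = tmul f s m + tmul f s n :=
  letI := f.toAlgebra
  TensorProduct.tmul_add s m n

theorem tmul_zero (s : S) : tmul f s (0 : M) = 0 :=
  letI := f.toAlgebra
  TensorProduct.tmul_zero M s

theorem add_tmul (s t : S) (m : M) : tmul f (s + t) m = tmul f s m + tmul f t m :=
  letI := f.toAlgebra
  TensorProduct.add_tmul s t m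

theorem smul_tmul (s t : S) (m : M) : s • tmul f t m = tmul f (s * t) m :=
  rfl

theorem mul_tmul (s : S) (a : A) (m : M) : tmul f (s * f a) m = tmul f s (a • m) := by
  let := f.toAlgebra
  have h : s * f a = a • s := by rw [Algebra.smul_def, mul_comm]; rfl
  rw [h]
  exact TensorProduct.smul_tmul a s m

variable {f}

@[elab_as_elim]
theorem induction_on {motive : BaseChange f M → Prop} (z : BaseChange f M)
    (zero : motive 0) (tmul : ∀ s m, motive (tmul f s m))
    (add : ∀ x y, motive x → motive y → motive (x + y)) : motive z :=
  letI := f.toAlgebra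
  TensorProduct.induction_on (motive := motive) z zero tmul add

theorem addHom_ext {P : Type*} [AddCommGroup P] {g h : BaseChange f M →+ P}
    (H : ∀ s m, g (tmul f s m) = h (tmul f s m)) : g = h := by
  ext z
  induction z using induction_on with
  | zero => simp
  | tmul s m => exact H s m
  | add x y hx hy => rw [map_add, map_add, hx, hy]

variable (f)

/-- The additive map out of `S ⊗[A] M` given by a balanced biadditive map. -/
noncomputable def liftAdd {P : Type*} [AddCommGroup P] (φ : S → M → P)
    (hl : ∀ s t m, φ (s + t) m = φ s m + φ t m) (hr : ∀ s m n, φ s (m + n) = φ s m + φ s n)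
    (h : ∀ (s : S) (a : A) (m : M), φ (s * f a) m = φ s (a • m)) : BaseChange f M →+ P :=
  letI := f.toAlgebra
  TensorProduct.liftAddHom
    (AddMonoidHom.mk' (fun s => AddMonoidHom.mk' (φ s) (hr s)) fun s t => by
      ext m; exact hl s t m)
    fun a s m => by
      rw [Algebra.smul_def, mul_comm]; exact h s a m

@[simp]
theorem liftAdd_tmul {P : Type*} [AddCommGroup P] (φ : S → M → P)
    (hl : ∀ s t m, φ (s + t) m = φ s m + φ t m) (hr : ∀ s m n, φ s (m + n) = φ s m + φ s n)
    (h : ∀ (s : S) (a : A) (m : M), φ (s * f a) m = φ s (a • m)) (s : S) (m : M) :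
    liftAdd f φ hl hr h (tmul f s m) = φ s m :=
  rfl

/-- `s ⊗ m ↦ s • g m` for an `f`-semilinear map `g` to an `S`-module. -/
noncomputable def lift {P : Type u} [AddCommGroup P] [Module S P] (g : M →ₛₗ[f] P) :
    BaseChange f M →ₗ[S] P where
  toFun := liftAdd f (fun s m => s • g m) (fun s t m => add_smul s t (g m))
    (fun s m n => by simp) (fun s a m => by simp [mul_smul])
  map_add' := map_add _
  map_smul' s z := by
    induction z using induction_on with
    | zero => simp
    | tmul t m => rw [smul_tmul]; simp [mul_smul]
    | add x y hx hy => simp only [smul_add, map_add, hx, hy]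

@[simp]
theorem lift_tmul {P : Type u} [AddCommGroup P] [Module S P] (g : M →ₛₗ[f] P) (s : S) (m : M) :
    lift f g (tmul f s m) = s • g m :=
  rfl

/-- `1 ⊗ φ : S ⊗[A] M → S ⊗[A] N`. -/
noncomputable def map {N : Type u} [AddCommGroup N] [Module A N] (φ : M →ₗ[A] N) :
    BaseChange f M →ₗ[S] BaseChange f N :=
  lift f
    { toFun := fun m => tmul f 1 (φ m)
      map_add' := fun m n => by rw [map_add, tmul_add]
      map_smul' := fun a m => by rw [map_smul, ← mul_tmul, smul_tmul, one_mul, mul_one] }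

@[simp]
theorem map_tmul {N : Type u} [AddCommGroup N] [Module A N] (φ : M →ₗ[A] N) (s : S) (m : M) :
    map f φ (tmul f s m) = tmul f s (φ m) := by
  simp only [map, lift_tmul, LinearMap.coe_mk, AddHom.coe_mk, smul_tmul, mul_one]

theorem map_id : map f (LinearMap.id : M →ₗ[A] M) = LinearMap.id := by
  ext z
  induction z using induction_on with
  | zero => simp
  | tmul s m => simp
  | add x y hx hy => rw [map_add, map_add, hx, hy]

theorem map_comp {N P : Type u} [AddCommGroup N] [Module A N] [AddCommGroup P] [Module A P]
    (φ : M →ₗ[A] N) (χ : N →ₗ[A] P) : map f (χ ∘ₗ φ) = map f χ ∘ₗ map f φ := by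
  ext z
  induction z using induction_on with
  | zero => simp
  | tmul s m => simp
  | add x y hx hy => rw [map_add, map_add, hx, hy]

end BaseChange

/-- The commutative ring `S ⊗[A] T`, where `S` and `T` are `A`-algebras through `f` and `g`. -/
def RingTensor {A S T : Type u} [CommRing A] [CommRing S] [CommRing T]
    (f : A →+* S) (g : A →+* T) : Type u :=
  letI := f.toAlgebra
  letI := g.toAlgebra
  TensorProduct A S T

namespace RingTensor

variable {A S T : Type u} [CommRing A] [CommRing S] [CommRing T] (f : A →+* S) (g : A →+* T)

noncomputable instance : CommRing (RingTensor f g) :=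
  letI := f.toAlgebra
  letI := g.toAlgebra
  (inferInstance : CommRing (TensorProduct A S T))

/-- `s ↦ s ⊗ 1`. -/
noncomputable def inl : S →+* RingTensor f g :=
  letI := f.toAlgebra
  letI := g.toAlgebra
  (Algebra.TensorProduct.includeLeft (R := A) (S := A) (A := S) (B := T)).toRingHom

/-- `t ↦ 1 ⊗ t`. -/
noncomputable def inr : T →+* RingTensor f g :=
  letI := f.toAlgebra
  letI := g.toAlgebra
  (Algebra.TensorProduct.includeRight (R := A) (A := S) (B := T)).toRingHom

theorem condition : (inl f g).comp f = (inr f g).comp g := by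
  let := f.toAlgebra
  let := g.toAlgebra
  ext a
  exact (Algebra.TensorProduct.includeLeft (R := A) (S := A) (A := S) (B := T)).commutes a |>.trans
    ((Algebra.TensorProduct.includeRight (R := A) (A := S) (B := T)).commutes a).symm

variable {f g}

@[elab_as_elim]
theorem induction_on {motive : RingTensor f g → Prop} (z : RingTensor f g)
    (zero : motive 0) (tmul : ∀ s t, motive (inl f g s * inr f g t))
    (add : ∀ x y, motive x → motive y → motive (x + y)) : motive z := by
  let := f.toAlgebra
  let := g.toAlgebra
  refine TensorProduct.induction_on (motive := motive) z zero (fun s t => ?_) add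
  have h : (TensorProduct.tmul A s t : TensorProduct A S T) =
      TensorProduct.tmul A s 1 * TensorProduct.tmul A 1 t := by
    rw [Algebra.TensorProduct.tmul_mul_tmul, mul_one, one_mul]
  rw [h]
  exact tmul s t

/-- The ring homomorphism `s ⊗ t ↦ p s * q t`. -/
noncomputable def lift {R : Type u} [CommRing R] (p : S →+* R) (q : T →+* R)
    (h : p.comp f = q.comp g) : RingTensor f g →+* R :=
  letI := f.toAlgebra
  letI := g.toAlgebra
  letI := (p.comp f).toAlgebra
  (Algebra.TensorProduct.lift (R := A) (S := A)
    ({ p with commutes' := fun _ => rfl } : S →ₐ[A] R)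
    ({ q with commutes' := fun a => (RingHom.congr_fun h a).symm } : T →ₐ[A] R)
    (fun _ _ => mul_comm _ _)).toRingHom

@[simp]
theorem lift_comp_inl {R : Type u} [CommRing R] (p : S →+* R) (q : T →+* R)
    (h : p.comp f = q.comp g) : (lift p q h).comp (inl f g) = p := by
  let := f.toAlgebra
  let := g.toAlgebra
  let := (p.comp f).toAlgebra
  ext s
  change p s * q 1 = p s
  simp

@[simp]
theorem lift_comp_inr {R : Type u} [CommRing R] (p : S →+* R) (q : T →+* R)
    (h : p.comp f = q.comp g) : (lift p q h).comp (inr f g) = q := by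
  let := f.toAlgebra
  let := g.toAlgebra
  let := (p.comp f).toAlgebra
  ext t
  change p 1 * q t = q t
  simp

@[simp]
theorem lift_inl {R : Type u} [CommRing R] (p : S →+* R) (q : T →+* R)
    (h : p.comp f = q.comp g) (s : S) : lift p q h (inl f g s) = p s :=
  RingHom.congr_fun (lift_comp_inl p q h) s

@[simp]
theorem lift_inr {R : Type u} [CommRing R] (p : S →+* R) (q : T →+* R)
    (h : p.comp f = q.comp g) (t : T) : lift p q h (inr f g t) = q t :=
  RingHom.congr_fun (lift_comp_inr p q h) t

theorem hom_ext {R : Type u} [CommRing R] {p q : RingTensor f g →+* R}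
    (hl : p.comp (inl f g) = q.comp (inl f g)) (hr : p.comp (inr f g) = q.comp (inr f g)) :
    p = q := by
  ext z
  induction z using induction_on with
  | zero => simp
  | tmul s t =>
    rw [map_mul, map_mul]
    exact congrArg₂ _ (RingHom.congr_fun hl s) (RingHom.congr_fun hr t)
  | add x y hx hy => rw [map_add, map_add, hx, hy]

theorem inl_mul_inr_mul (s : S) (a : A) (t : T) :
    inl f g (s * f a) * inr f g t = inl f g s * inr f g (g a * t) := by
  have := RingHom.congr_fun (condition f g) a
  simp only [RingHom.comp_apply] at this
  rw [map_mul, map_mul, this, mul_assoc]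

theorem comp_lift {R R' : Type u} [CommRing R] [CommRing R'] (k : R →+* R') (p : S →+* R)
    (q : T →+* R) (h : p.comp f = q.comp g) : k.comp (lift p q h) =
      lift (k.comp p) (k.comp q) (by rw [RingHom.comp_assoc, h, RingHom.comp_assoc]) := by
  apply hom_ext
  · rw [RingHom.comp_assoc, lift_comp_inl, lift_comp_inl]
  · rw [RingHom.comp_assoc, lift_comp_inr, lift_comp_inr]

theorem lift_congr {R : Type u} [CommRing R] {p p' : S →+* R} {q q' : T →+* R} (hp : p = p')
    (hq : q = q') (h : p.comp f = q.comp g) :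
    lift p q h = lift p' q' (by rw [← hp, ← hq, h]) := by
  subst hp hq
  rfl

theorem lift_comp_eta {R : Type u} [CommRing R] (k : RingTensor f g →+* R) :
    lift (k.comp (inl f g)) (k.comp (inr f g))
      (by rw [RingHom.comp_assoc, condition, RingHom.comp_assoc]) = k :=
  hom_ext (lift_comp_inl ..) (lift_comp_inr ..)

theorem comp_lift_comp {Q R R' : Type u} [CommRing Q] [CommRing R] [CommRing R'] (k : R →+* R')
    (p : S →+* R) (q : T →+* R) (h : p.comp f = q.comp g) (d : Q →+* RingTensor f g) :
    k.comp ((lift p q h).comp d) =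
      (lift (k.comp p) (k.comp q)
        (by rw [RingHom.comp_assoc, h, RingHom.comp_assoc])).comp d := by
  rw [← RingHom.comp_assoc, comp_lift]

/-- The additive map out of `S ⊗[A] T` given by a balanced biadditive map. -/
noncomputable def liftAdd {P : Type*} [AddCommGroup P] (φ : S → T → P)
    (hl : ∀ s s' t, φ (s + s') t = φ s t + φ s' t) (hr : ∀ s t t', φ s (t + t') = φ s t + φ s t')
    (h : ∀ (s : S) (a : A) (t : T), φ (s * f a) t = φ s (g a * t)) : RingTensor f g →+ P :=
  letI := f.toAlgebra
  letI := g.toAlgebra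
  TensorProduct.liftAddHom
    (AddMonoidHom.mk' (fun s => AddMonoidHom.mk' (φ s) (hr s)) fun s t => by
      ext m; exact hl s t m)
    fun a s t => by
      rw [Algebra.smul_def, Algebra.smul_def, mul_comm]; exact h s a t

@[simp]
theorem liftAdd_inl_mul_inr {P : Type*} [AddCommGroup P] (φ : S → T → P)
    (hl : ∀ s s' t, φ (s + s') t = φ s t + φ s' t) (hr : ∀ s t t', φ s (t + t') = φ s t + φ s t')
    (h : ∀ (s : S) (a : A) (t : T), φ (s * f a) t = φ s (g a * t)) (s : S) (t : T) :
    liftAdd φ hl hr h (inl f g s * inr f g t) = φ s t := by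
  let := f.toAlgebra
  let := g.toAlgebra
  have e : inl f g s * inr f g t = (TensorProduct.tmul A s t : TensorProduct A S T) :=
    (Algebra.TensorProduct.tmul_mul_tmul s 1 1 t).trans (by rw [mul_one, one_mul])
  exact congrArg (liftAdd φ hl hr h) e

theorem addHom_ext {P : Type*} [AddCommGroup P] {p q : RingTensor f g →+ P}
    (H : ∀ s t, p (inl f g s * inr f g t) = q (inl f g s * inr f g t)) : p = q := by
  ext z
  induction z using induction_on with
  | zero => simp
  | tmul s t => exact H s t
  | add x y hx hy => rw [map_add, map_add, hx, hy]

end RingTensor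

/-! ### Hopf algebroids -/

/-- A Hopf algebroid `(A, Γ)`: a cogroupoid object in commutative rings. In `Γ ⊗[A] Γ` the first
factor is an `A`-module through the right unit and the second one through the left unit. -/
structure HopfAlgebroid (A Γ : Type u) [CommRing A] [CommRing Γ] where
  /-- left unit -/
  ηL : A →+* Γ
  /-- right unit -/
  ηR : A →+* Γ
  /-- counit -/
  ε : Γ →+* A
  /-- diagonal -/
  Δ : Γ →+* RingTensor ηR ηL
  /-- conjugation -/
  χ : Γ →+* Γ
  ε_ηL : ε.comp ηL = RingHom.id A
  ε_ηR : ε.comp ηR = RingHom.id A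
  Δ_ηL : Δ.comp ηL = (RingTensor.inl ηR ηL).comp ηL
  Δ_ηR : Δ.comp ηR = (RingTensor.inr ηR ηL).comp ηR
  χ_ηL : χ.comp ηL = ηR
  χ_ηR : χ.comp ηR = ηL
  χ_χ : χ.comp χ = RingHom.id Γ
  /-- `(ε ⊗ 1) Δ = 1` -/
  counit_left : (RingTensor.lift (ηL.comp ε) (RingHom.id Γ)
    (by rw [RingHom.comp_assoc, ε_ηR, RingHom.comp_id, RingHom.id_comp])).comp Δ = RingHom.id Γ
  /-- `(1 ⊗ ε) Δ = 1` -/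
  counit_right : (RingTensor.lift (RingHom.id Γ) (ηR.comp ε)
    (by rw [RingHom.comp_assoc, ε_ηL, RingHom.comp_id, RingHom.id_comp])).comp Δ = RingHom.id Γ
  /-- `(Δ ⊗ 1) Δ = (1 ⊗ Δ) Δ` as maps to `Γ ⊗[A] (Γ ⊗[A] Γ)` -/
  coassoc :
    (RingTensor.lift
      ((RingTensor.lift (RingTensor.inl ηR ((RingTensor.inl ηR ηL).comp ηL))
        ((RingTensor.inr ηR ((RingTensor.inl ηR ηL).comp ηL)).comp (RingTensor.inl ηR ηL))
        (by rw [RingTensor.condition, RingHom.comp_assoc])).comp Δ)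
      ((RingTensor.inr ηR ((RingTensor.inl ηR ηL).comp ηL)).comp (RingTensor.inr ηR ηL))
      (by rw [RingHom.comp_assoc, Δ_ηR, ← RingHom.comp_assoc, RingTensor.lift_comp_inr,
        RingHom.comp_assoc, RingTensor.condition, RingHom.comp_assoc])).comp Δ =
    (RingTensor.lift (RingTensor.inl ηR ((RingTensor.inl ηR ηL).comp ηL))
      ((RingTensor.inr ηR ((RingTensor.inl ηR ηL).comp ηL)).comp Δ)
      (by rw [RingTensor.condition, RingHom.comp_assoc, Δ_ηL])).comp Δ
  /-- `μ (1 ⊗ χ) Δ = ηL ε` -/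
  conj_right : (RingTensor.lift (RingHom.id Γ) χ
    (by rw [χ_ηL, RingHom.id_comp])).comp Δ = ηL.comp ε
  /-- `μ (χ ⊗ 1) Δ = ηR ε` -/
  conj_left : (RingTensor.lift χ (RingHom.id Γ)
    (by rw [χ_ηR, RingHom.id_comp])).comp Δ = ηR.comp ε

namespace HopfAlgebroid

/-- Coassociativity, for three composable `R`-valued points of `Γ`. -/
theorem coassoc_points {A Γ R : Type u} [CommRing A] [CommRing Γ] [CommRing R]
    (H : HopfAlgebroid A Γ) (i j k : Γ →+* R) (hij : i.comp H.ηR = j.comp H.ηL)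
    (hjk : j.comp H.ηR = k.comp H.ηL) :
    (RingTensor.lift ((RingTensor.lift i j hij).comp H.Δ) k
      (by rw [RingHom.comp_assoc, H.Δ_ηR, ← RingHom.comp_assoc, RingTensor.lift_comp_inr,
        hjk])).comp H.Δ =
    (RingTensor.lift i ((RingTensor.lift j k hjk).comp H.Δ)
      (by rw [RingHom.comp_assoc, H.Δ_ηL, ← RingHom.comp_assoc, RingTensor.lift_comp_inl,
        hij])).comp H.Δ := by
  have hK : i.comp H.ηR = (RingTensor.lift j k hjk).comp ((RingTensor.inl H.ηR H.ηL).comp H.ηL) := by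
    rw [← RingHom.comp_assoc, RingTensor.lift_comp_inl, hij]
  have h := congrArg (RingTensor.lift i (RingTensor.lift j k hjk) hK).comp H.coassoc
  refine Eq.trans ?_ (Eq.trans h ?_)
  · rw [RingTensor.comp_lift_comp]
    refine congrArg (fun z => RingHom.comp z H.Δ) (RingTensor.lift_congr ?_ ?_ _)
    · rw [RingTensor.comp_lift_comp]
      refine congrArg (fun z => RingHom.comp z H.Δ) (RingTensor.lift_congr ?_ ?_ _)
      · rw [RingTensor.lift_comp_inl]
      · rw [← RingHom.comp_assoc, RingTensor.lift_comp_inr, RingTensor.lift_comp_inl]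
    · rw [← RingHom.comp_assoc, RingTensor.lift_comp_inr, RingTensor.lift_comp_inr]
  · rw [RingTensor.comp_lift_comp]
    refine congrArg (fun z => RingHom.comp z H.Δ) (RingTensor.lift_congr ?_ ?_ _)
    · rw [RingTensor.lift_comp_inl]
    · rw [← RingHom.comp_assoc, RingTensor.lift_comp_inr]

/-- A Hopf algebroid is flat if its right unit is a flat ring homomorphism. -/
def IsFlat {A Γ : Type u} [CommRing A] [CommRing Γ] (H : HopfAlgebroid A Γ) : Prop :=
  H.ηR.Flat

/-- A map `(A, Γ) → (B, S)` of Hopf algebroids. -/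
structure Hom {A Γ B S : Type u} [CommRing A] [CommRing Γ] [CommRing B] [CommRing S]
    (H : HopfAlgebroid A Γ) (K : HopfAlgebroid B S) where
  Φ₀ : A →+* B
  Φ₁ : Γ →+* S
  map_ηL : Φ₁.comp H.ηL = K.ηL.comp Φ₀
  map_ηR : Φ₁.comp H.ηR = K.ηR.comp Φ₀
  map_ε : Φ₀.comp H.ε = K.ε.comp Φ₁
  map_χ : Φ₁.comp H.χ = K.χ.comp Φ₁
  /-- `(Φ₁ ⊗ Φ₁) Δ = Δ Φ₁` -/
  map_Δ : (RingTensor.lift ((RingTensor.inl K.ηR K.ηL).comp Φ₁)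
    ((RingTensor.inr K.ηR K.ηL).comp Φ₁)
    (by rw [RingHom.comp_assoc, map_ηR, ← RingHom.comp_assoc, RingTensor.condition,
      RingHom.comp_assoc, RingHom.comp_assoc, map_ηL])).comp H.Δ = K.Δ.comp Φ₁

/-! ### Comodules -/

section Comodule

variable {A Γ : Type u} [CommRing A] [CommRing Γ] (H : HopfAlgebroid A Γ)

/-- The left `A`-module `Γ ⊗[A] M`: in the tensor product `Γ` is a right `A`-module through `ηR`,
and `A` acts on the result on the left through `ηL`. -/
def Extended (M : Type u) [AddCommGroup M] [Module A M] : Type u :=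
  BaseChange H.ηR M

namespace Extended

variable (M : Type u) [AddCommGroup M] [Module A M]

noncomputable instance : AddCommGroup (H.Extended M) :=
  (inferInstance : AddCommGroup (BaseChange H.ηR M))

noncomputable instance : Module Γ (H.Extended M) :=
  (inferInstance : Module Γ (BaseChange H.ηR M))

noncomputable instance : Module A (H.Extended M) :=
  Module.compHom (H.Extended M) H.ηL

variable {M}

theorem smul_def (a : A) (z : H.Extended M) : a • z = H.ηL a • z :=
  rfl

/-- `x ⊗ m` -/
noncomputable def tmul (x : Γ) (m : M) : H.Extended M :=
  BaseChange.tmul H.ηR x m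

theorem tmul_add (x : Γ) (m n : M) : tmul H x (m + n) = tmul H x m + tmul H x n :=
  BaseChange.tmul_add _ x m n

theorem add_tmul (x y : Γ) (m : M) : tmul H (x + y) m = tmul H x m + tmul H y m :=
  BaseChange.add_tmul _ x y m

theorem smul_tmul (x y : Γ) (m : M) : x • tmul H y m = tmul H (x * y) m :=
  rfl

theorem mul_tmul (x : Γ) (a : A) (m : M) : tmul H (x * H.ηR a) m = tmul H x (a • m) :=
  BaseChange.mul_tmul _ x a m

variable {H}

@[elab_as_elim]
theorem induction_on {motive : H.Extended M → Prop} (z : H.Extended M)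
    (zero : motive 0) (tmul : ∀ s m, motive (tmul H s m))
    (add : ∀ x y, motive x → motive y → motive (x + y)) : motive z :=
  BaseChange.induction_on (motive := motive) z zero tmul add

theorem addHom_ext {P : Type*} [AddCommGroup P] {g h : H.Extended M →+ P}
    (hh : ∀ s m, g (tmul H s m) = h (tmul H s m)) : g = h :=
  BaseChange.addHom_ext hh

variable (H)

/-- The additive map out of `Γ ⊗[A] M` given by a balanced biadditive map. -/
noncomputable def liftAdd {P : Type*} [AddCommGroup P] (φ : Γ → M → P)
    (hl : ∀ s t m, φ (s + t) m = φ s m + φ t m) (hr : ∀ s m n, φ s (m + n) = φ s m + φ s n)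
    (h : ∀ (s : Γ) (a : A) (m : M), φ (s * H.ηR a) m = φ s (a • m)) : H.Extended M →+ P :=
  BaseChange.liftAdd H.ηR φ hl hr h

@[simp]
theorem liftAdd_tmul {P : Type*} [AddCommGroup P] (φ : Γ → M → P)
    (hl : ∀ s t m, φ (s + t) m = φ s m + φ t m) (hr : ∀ s m n, φ s (m + n) = φ s m + φ s n)
    (h : ∀ (s : Γ) (a : A) (m : M), φ (s * H.ηR a) m = φ s (a • m)) (s : Γ) (m : M) :
    liftAdd H φ hl hr h (tmul H s m) = φ s m :=
  rfl

/-- `1 ⊗ φ : Γ ⊗[A] M → Γ ⊗[A] N`. -/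
noncomputable def map {N : Type u} [AddCommGroup N] [Module A N] (φ : M →ₗ[A] N) :
    H.Extended M →ₗ[A] H.Extended N where
  toFun := BaseChange.map H.ηR φ
  map_add' := map_add _
  map_smul' a z := (BaseChange.map H.ηR φ).map_smul (H.ηL a) z

@[simp]
theorem map_tmul {N : Type u} [AddCommGroup N] [Module A N] (φ : M →ₗ[A] N) (x : Γ) (m : M) :
    map H φ (tmul H x m) = tmul H x (φ m) :=
  BaseChange.map_tmul _ φ x m

theorem map_smul_left {N : Type u} [AddCommGroup N] [Module A N] (φ : M →ₗ[A] N) (x : Γ)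
    (z : H.Extended M) : map H φ (x • z) = x • map H φ z :=
  (BaseChange.map H.ηR φ).map_smul x z

theorem map_id : map H (LinearMap.id : M →ₗ[A] M) = LinearMap.id := by
  ext z
  exact LinearMap.congr_fun (BaseChange.map_id (M := M) H.ηR) z

theorem map_comp {N P : Type u} [AddCommGroup N] [Module A N] [AddCommGroup P] [Module A P]
    (φ : M →ₗ[A] N) (χ : N →ₗ[A] P) : map H (χ ∘ₗ φ) = map H χ ∘ₗ map H φ := by
  ext z
  exact LinearMap.congr_fun (BaseChange.map_comp H.ηR φ χ) z

theorem map_add_left {N : Type u} [AddCommGroup N] [Module A N] (φ χ : M →ₗ[A] N)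
    (z : H.Extended M) : map H (φ + χ) z = map H φ z + map H χ z := by
  induction z using induction_on with
  | zero => simp
  | tmul x m => simp [tmul_add]
  | add x y hx hy => rw [map_add, map_add, map_add, hx, hy]; abel

/-- `Γ ⊗[A] f` for varying `f`, as an additive map. -/
noncomputable def mapHom (M N : Type u) [AddCommGroup M] [Module A M] [AddCommGroup N]
    [Module A N] : (M →ₗ[A] N) →+ (H.Extended M →ₗ[A] H.Extended N) :=
  AddMonoidHom.mk' (map H) fun φ χ => by ext z; exact map_add_left H φ χ z

variable (M) in
/-- `ε ⊗ 1 : Γ ⊗[A] M → M`, `x ⊗ m ↦ ε x • m`. -/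
noncomputable def counit : H.Extended M →+ M :=
  liftAdd H (fun x m => H.ε x • m) (fun x y m => by rw [map_add, add_smul])
    (fun x m n => smul_add _ _ _) (fun x a m => by
      have := RingHom.congr_fun H.ε_ηR a
      simp only [RingHom.comp_apply, RingHom.id_apply] at this
      rw [map_mul, this, mul_smul])

@[simp]
theorem counit_tmul (x : Γ) (m : M) : counit H M (tmul H x m) = H.ε x • m :=
  rfl

/-- `Γ ⊗[A] Γ → Γ ⊗[A] (Γ ⊗[A] M)`, `x ⊗ y ↦ x ⊗ (y ⊗ m)`. -/
noncomputable def tmulRight (m : M) : RingTensor H.ηR H.ηL →+ H.Extended (H.Extended M) :=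
  RingTensor.liftAdd (fun x y => tmul H x (tmul H y m)) (fun x y z => add_tmul H x y _)
    (fun x y z => by rw [add_tmul, tmul_add])
    (fun x a y => by rw [mul_tmul, smul_def, smul_tmul])

@[simp]
theorem tmulRight_tmul (m : M) (x y : Γ) :
    tmulRight H m (RingTensor.inl _ _ x * RingTensor.inr _ _ y) = tmul H x (tmul H y m) :=
  RingTensor.liftAdd_inl_mul_inr _ _ _ _ x y

theorem tmulRight_add (m n : M) (z : RingTensor H.ηR H.ηL) :
    tmulRight H (m + n) z = tmulRight H m z + tmulRight H n z := by
  induction z using RingTensor.induction_on with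
  | zero => simp
  | tmul x y => simp [tmul_add]
  | add x y hx hy => rw [map_add, map_add, map_add, hx, hy]; abel

theorem tmulRight_mul_inr (m : M) (a : A) (z : RingTensor H.ηR H.ηL) :
    tmulRight H m (z * RingTensor.inr _ _ (H.ηR a)) = tmulRight H (a • m) z := by
  induction z using RingTensor.induction_on with
  | zero => simp
  | tmul x y => rw [mul_assoc, ← map_mul, tmulRight_tmul, tmulRight_tmul, mul_tmul]
  | add x y hx hy => rw [add_mul, map_add, map_add, hx, hy]

theorem tmulRight_inl_mul (m : M) (x : Γ) (z : RingTensor H.ηR H.ηL) :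
    tmulRight H m (RingTensor.inl _ _ x * z) = x • tmulRight H m z := by
  induction z using RingTensor.induction_on with
  | zero => simp
  | tmul x y => rw [← mul_assoc, ← map_mul, tmulRight_tmul, tmulRight_tmul, smul_tmul]
  | add x y hx hy => rw [mul_add, map_add, map_add, hx, hy, smul_add]

variable (M) in
/-- `Δ ⊗ 1 : Γ ⊗[A] M → Γ ⊗[A] (Γ ⊗[A] M)`. -/
noncomputable def comul : H.Extended M →+ H.Extended (H.Extended M) :=
  liftAdd H (fun x m => tmulRight H m (H.Δ x)) (fun x y m => by rw [map_add, map_add])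
    (fun x m n => tmulRight_add H m n _) (fun x a m => by
      have := RingHom.congr_fun H.Δ_ηR a
      simp only [RingHom.comp_apply] at this
      rw [map_mul, this, tmulRight_mul_inr])

@[simp]
theorem comul_tmul (x : Γ) (m : M) : comul H M (tmul H x m) = tmulRight H m (H.Δ x) :=
  rfl

theorem comul_smul (a : A) (z : H.Extended M) : comul H M (a • z) = a • comul H M z := by
  have h := RingHom.congr_fun H.Δ_ηL a
  simp only [RingHom.comp_apply] at h
  induction z using induction_on with
  | zero => simp
  | tmul x m =>
    rw [smul_def, smul_tmul, comul_tmul, map_mul, h, tmulRight_inl_mul, comul_tmul, smul_def]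
  | add x y hx hy => rw [smul_add, map_add, map_add, hx, hy, smul_add]

theorem counit_smul (a : A) (z : H.Extended M) : counit H M (a • z) = a • counit H M z := by
  have h := RingHom.congr_fun H.ε_ηL a
  simp only [RingHom.comp_apply, RingHom.id_apply] at h
  induction z using induction_on with
  | zero => simp
  | tmul x m => rw [smul_def, smul_tmul, counit_tmul, map_mul, h, mul_smul, counit_tmul]
  | add x y hx hy => rw [smul_add, map_add, map_add, hx, hy, smul_add]

end Extended

/-- A (left) `Γ`-comodule: a left `A`-module with a counital and coassociative coaction
`ψ : M → Γ ⊗[A] M`. -/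
structure Comod where
  carrier : Type u
  [addCommGroup : AddCommGroup carrier]
  [module : Module A carrier]
  /-- the coaction -/
  ψ : carrier →ₗ[A] H.Extended carrier
  /-- `(ε ⊗ 1) ψ = 1` -/
  counit_ψ : ∀ m, Extended.counit H carrier (ψ m) = m
  /-- `(1 ⊗ ψ) ψ = (Δ ⊗ 1) ψ` -/
  coassoc_ψ : ∀ m, Extended.map H ψ (ψ m) = Extended.comul H carrier (ψ m)

namespace Comod

attribute [instance] Comod.addCommGroup Comod.module

variable {H}

/-- A map of comodules. -/
@[ext]
structure Hom (M N : Comod H) where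
  toLinearMap : M.carrier →ₗ[A] N.carrier
  comm : ∀ m, N.ψ (toLinearMap m) = Extended.map H toLinearMap (M.ψ m)

noncomputable instance : Category (Comod H) where
  Hom := Hom
  id M := ⟨LinearMap.id, fun m => by rw [Extended.map_id]; rfl⟩
  comp f g := ⟨g.toLinearMap ∘ₗ f.toLinearMap, fun m => by
    rw [Extended.map_comp, LinearMap.comp_apply, LinearMap.comp_apply, g.comm, f.comm]⟩

/-- The `A`-linear map underlying a map of comodules. -/
def linearMap {M N : Comod H} (f : M ⟶ N) : M.carrier →ₗ[A] N.carrier :=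
  Hom.toLinearMap f

theorem linearMap_injective (M N : Comod H) :
    Function.Injective (linearMap : (M ⟶ N) → (M.carrier →ₗ[A] N.carrier)) :=
  fun _ _ h => Hom.ext h

theorem ψ_linearMap {M N : Comod H} (f : M ⟶ N) (m : M.carrier) :
    N.ψ (linearMap f m) = Extended.map H (linearMap f) (M.ψ m) :=
  Hom.comm f m

@[simp]
theorem linearMap_id (M : Comod H) : linearMap (𝟙 M) = LinearMap.id :=
  rfl

@[simp]
theorem linearMap_comp {M N P : Comod H} (f : M ⟶ N) (g : N ⟶ P) :
    linearMap (f ≫ g) = linearMap g ∘ₗ linearMap f :=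
  rfl

/-- The maps of comodules form a subgroup of the group of linear maps. -/
noncomputable def homSubgroup (M N : Comod H) : AddSubgroup (M.carrier →ₗ[A] N.carrier) where
  carrier := {f | ∀ m, N.ψ (f m) = Extended.mapHom H _ _ f (M.ψ m)}
  zero_mem' m := by simp
  add_mem' {f g} hf hg m := by
    rw [map_add, LinearMap.add_apply, LinearMap.add_apply, map_add, hf, hg]
  neg_mem' {f} hf m := by
    rw [map_neg, LinearMap.neg_apply, LinearMap.neg_apply, map_neg, hf]

/-- Maps of comodules as elements of `homSubgroup`. -/
noncomputable def homEquiv (M N : Comod H) : (M ⟶ N) ≃ homSubgroup M N where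
  toFun f := ⟨linearMap f, ψ_linearMap f⟩
  invFun f := Hom.mk f.1 f.2

noncomputable instance (M N : Comod H) : AddCommGroup (M ⟶ N) :=
  (homEquiv M N).addCommGroup

@[simp]
theorem linearMap_add {M N : Comod H} (f g : M ⟶ N) :
    linearMap (f + g) = linearMap f + linearMap g :=
  rfl

@[simp]
theorem linearMap_zero (M N : Comod H) : linearMap (0 : M ⟶ N) = 0 :=
  rfl

noncomputable instance : Preadditive (Comod H) where
  add_comp M N P f g h := linearMap_injective _ _ <| by
    simp [LinearMap.comp_add]
  comp_add M N P f g h := linearMap_injective _ _ <| by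
    simp [LinearMap.add_comp]

end Comod
end Comodule

/-! ### The functor `Φ_*` on comodules -/

namespace Hom

variable {A Γ B S : Type u} [CommRing A] [CommRing Γ] [CommRing B] [CommRing S]
  {H : HopfAlgebroid A Γ} {K : HopfAlgebroid B S} (Φ : Hom H K)

section

variable (M : Type u) [AddCommGroup M] [Module A M]

/-- `Γ ⊗[A] M → S ⊗[B] (B ⊗[A] M)`, `x ⊗ m ↦ Φ₁ x ⊗ (1 ⊗ m)`. -/
noncomputable def extendedMap : H.Extended M →+ K.Extended (BaseChange Φ.Φ₀ M) :=
  Extended.liftAdd H (fun x m => Extended.tmul K (Φ.Φ₁ x) (BaseChange.tmul Φ.Φ₀ 1 m))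
    (fun x y m => by rw [map_add, Extended.add_tmul])
    (fun x m n => by rw [BaseChange.tmul_add, Extended.tmul_add])
    (fun x a m => by
      have h := RingHom.congr_fun Φ.map_ηR a
      simp only [RingHom.comp_apply] at h
      rw [map_mul, h, Extended.mul_tmul, BaseChange.smul_tmul, ← BaseChange.mul_tmul, mul_one,
        one_mul])

variable {M}

@[simp]
theorem extendedMap_tmul (x : Γ) (m : M) : Φ.extendedMap M (Extended.tmul H x m) =
    Extended.tmul K (Φ.Φ₁ x) (BaseChange.tmul Φ.Φ₀ 1 m) :=
  rfl

theorem extendedMap_smul (x : Γ) (z : H.Extended M) :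
    Φ.extendedMap M (x • z) = Φ.Φ₁ x • Φ.extendedMap M z := by
  induction z using Extended.induction_on with
  | zero => simp
  | tmul y m => rw [Extended.smul_tmul, extendedMap_tmul, map_mul, extendedMap_tmul,
      Extended.smul_tmul]
  | add x y hx hy => rw [smul_add, map_add, map_add, hx, hy, smul_add]

theorem extendedMap_smul' (a : A) (z : H.Extended M) :
    Φ.extendedMap M (a • z) = Φ.Φ₀ a • Φ.extendedMap M z := by
  have h := RingHom.congr_fun Φ.map_ηL a
  simp only [RingHom.comp_apply] at h
  rw [Extended.smul_def, extendedMap_smul, h, Extended.smul_def]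

theorem counit_extendedMap (z : H.Extended M) :
    Extended.counit K _ (Φ.extendedMap M z) =
      BaseChange.tmul Φ.Φ₀ 1 (Extended.counit H M z) := by
  induction z using Extended.induction_on with
  | zero => rw [map_zero, map_zero, map_zero, BaseChange.tmul_zero]
  | tmul x m =>
    have h := RingHom.congr_fun Φ.map_ε x
    simp only [RingHom.comp_apply] at h
    rw [extendedMap_tmul, Extended.counit_tmul, Extended.counit_tmul, ← h, BaseChange.smul_tmul,
      ← BaseChange.mul_tmul, mul_one, one_mul]
  | add x y hx hy => rw [map_add, map_add, map_add, hx, hy, BaseChange.tmul_add]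

end

/-- The coaction `B ⊗[A] M → S ⊗[B] (B ⊗[A] M)`: the composite of `1 ⊗ ψ` with
`b ⊗ (x ⊗ m) ↦ ηL b * Φ₁ x ⊗ (1 ⊗ m)`. -/
noncomputable def coaction (M : Comod H) :
    BaseChange Φ.Φ₀ M.carrier →ₗ[B] K.Extended (BaseChange Φ.Φ₀ M.carrier) :=
  BaseChange.lift Φ.Φ₀
    { toFun := fun m => Φ.extendedMap M.carrier (M.ψ m)
      map_add' := fun m n => by rw [map_add, map_add]
      map_smul' := fun a m => by rw [map_smul, extendedMap_smul'] }

theorem coaction_tmul (M : Comod H) (b : B) (m : M.carrier) :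
    Φ.coaction M (BaseChange.tmul Φ.Φ₀ b m) = b • Φ.extendedMap M.carrier (M.ψ m) :=
  rfl

/-- `Γ ⊗[A] (Γ ⊗[A] M) → S ⊗[B] (S ⊗[B] (B ⊗[A] M))`. -/
noncomputable def extendedMap₂ (M : Type u) [AddCommGroup M] [Module A M] :
    H.Extended (H.Extended M) →+ K.Extended (K.Extended (BaseChange Φ.Φ₀ M)) :=
  Extended.liftAdd H (fun x z => Extended.tmul K (Φ.Φ₁ x) (Φ.extendedMap M z))
    (fun x y m => by rw [map_add, Extended.add_tmul])
    (fun x m n => by rw [map_add, Extended.tmul_add])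
    (fun x a m => by
      have h := RingHom.congr_fun Φ.map_ηR a
      simp only [RingHom.comp_apply] at h
      rw [map_mul, h, Extended.mul_tmul, extendedMap_smul'])

theorem extendedMap₂_tmul {M : Type u} [AddCommGroup M] [Module A M] (x : Γ) (z : H.Extended M) :
    Φ.extendedMap₂ M (Extended.tmul H x z) = Extended.tmul K (Φ.Φ₁ x) (Φ.extendedMap M z) :=
  rfl

theorem extendedMap₂_map (M : Comod H) (z : H.Extended M.carrier) :
    Φ.extendedMap₂ M.carrier (Extended.map H M.ψ z) =
      Extended.map K (Φ.coaction M) (Φ.extendedMap M.carrier z) := by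
  induction z using Extended.induction_on with
  | zero => simp
  | tmul x m =>
    rw [Extended.map_tmul, extendedMap₂_tmul, extendedMap_tmul, Extended.map_tmul, coaction_tmul,
      one_smul]
  | add x y hx hy => rw [map_add, map_add, map_add, map_add, hx, hy]

theorem extendedMap₂_comul {M : Type u} [AddCommGroup M] [Module A M] (z : H.Extended M) :
    Φ.extendedMap₂ M (Extended.comul H M z) =
      Extended.comul K _ (Φ.extendedMap M z) := by
  induction z using Extended.induction_on with
  | zero => simp
  | tmul x m =>
    have h := RingHom.congr_fun Φ.map_Δ x
    simp only [RingHom.comp_apply] at h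
    rw [Extended.comul_tmul, extendedMap_tmul, Extended.comul_tmul, ← h]
    generalize H.Δ x = w
    induction w using RingTensor.induction_on with
    | zero => simp
    | tmul y z =>
      rw [Extended.tmulRight_tmul, extendedMap₂_tmul, extendedMap_tmul, map_mul,
        RingTensor.lift_inl, RingTensor.lift_inr, RingHom.comp_apply, RingHom.comp_apply,
        Extended.tmulRight_tmul]
    | add x y hx hy => rw [map_add, map_add, map_add, map_add, hx, hy]
  | add x y hx hy => rw [map_add, map_add, map_add, map_add, hx, hy]

/-- The comodule `Φ_* M`, with underlying `B`-module `B ⊗[A] M`. -/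
noncomputable def pushforwardObj (M : Comod H) : Comod K where
  carrier := BaseChange Φ.Φ₀ M.carrier
  ψ := Φ.coaction M
  counit_ψ z := by
    induction z using BaseChange.induction_on with
    | zero => simp
    | tmul b m =>
      rw [coaction_tmul, Extended.counit_smul, counit_extendedMap, M.counit_ψ,
        BaseChange.smul_tmul, mul_one]
    | add x y hx hy => rw [map_add, map_add, hx, hy]
  coassoc_ψ z := by
    induction z using BaseChange.induction_on with
    | zero => simp
    | tmul b m =>
      rw [coaction_tmul, map_smul, Extended.comul_smul, ← extendedMap₂_map, M.coassoc_ψ,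
        extendedMap₂_comul]
    | add x y hx hy => rw [map_add, map_add, map_add, hx, hy]

theorem extendedMap_map {M N : Type u} [AddCommGroup M] [Module A M] [AddCommGroup N] [Module A N]
    (φ : M →ₗ[A] N) (z : H.Extended M) :
    Φ.extendedMap N (Extended.map H φ z) =
      Extended.map K (BaseChange.map Φ.Φ₀ φ) (Φ.extendedMap M z) := by
  induction z using Extended.induction_on with
  | zero => simp
  | tmul x m => simp
  | add x y hx hy => rw [map_add, map_add, map_add, map_add, hx, hy]

theorem coaction_map {M N : Comod H} (φ : M ⟶ N) (z : BaseChange Φ.Φ₀ M.carrier) :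
    Φ.coaction N (BaseChange.map Φ.Φ₀ (Comod.linearMap φ) z) =
      Extended.map K (BaseChange.map Φ.Φ₀ (Comod.linearMap φ)) (Φ.coaction M z) := by
  induction z using BaseChange.induction_on with
  | zero => simp
  | tmul b m =>
    rw [BaseChange.map_tmul, coaction_tmul, coaction_tmul, map_smul, Comod.ψ_linearMap,
      extendedMap_map]
  | add x y hx hy => rw [map_add, map_add, map_add, map_add, hx, hy]

/-- The functor `Φ_* : Γ-comod ⥤ S-comod`, `M ↦ B ⊗[A] M`. -/
noncomputable def pushforward : Comod H ⥤ Comod K where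
  obj M := Φ.pushforwardObj M
  map {M N} φ := Comod.Hom.mk (M := Φ.pushforwardObj M) (N := Φ.pushforwardObj N)
    (BaseChange.map Φ.Φ₀ (Comod.linearMap φ)) (Φ.coaction_map φ)
  map_id _ := Comod.linearMap_injective _ _ (BaseChange.map_id Φ.Φ₀)
  map_comp f g := Comod.linearMap_injective _ _
    (BaseChange.map_comp Φ.Φ₀ (Comod.linearMap f) (Comod.linearMap g))

end Hom

/-! ### The Hopf algebroid `(B, Γ_B)` -/

section GammaB

variable {A Γ B : Type u} [CommRing A] [CommRing Γ] [CommRing B] (H : HopfAlgebroid A Γ)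
  (f : A →+* B)

/-- The ring `Γ_B = (B ⊗[A] Γ) ⊗[A] B`, where `Γ` is an `A`-algebra through `ηL` in the first
tensor product and through `ηR` in the second one. -/
abbrev GammaB : Type u :=
  RingTensor ((RingTensor.inr f H.ηL).comp H.ηR) f

namespace GammaB

/-- `b ↦ b ⊗ 1 ⊗ 1` -/
noncomputable def left : B →+* H.GammaB f :=
  (RingTensor.inl _ _).comp (RingTensor.inl f H.ηL)

/-- `x ↦ 1 ⊗ x ⊗ 1` -/
noncomputable def mid : Γ →+* H.GammaB f :=
  (RingTensor.inl _ _).comp (RingTensor.inr f H.ηL)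

/-- `b ↦ 1 ⊗ 1 ⊗ b` -/
noncomputable def right : B →+* H.GammaB f :=
  RingTensor.inr _ _

theorem mid_ηL : (mid H f).comp H.ηL = (left H f).comp f := by
  rw [mid, left, RingHom.comp_assoc, RingHom.comp_assoc, RingTensor.condition]

theorem mid_ηR : (mid H f).comp H.ηR = (right H f).comp f := by
  rw [mid, right, ← RingTensor.condition, RingHom.comp_assoc]

variable {H f} {R : Type u} [CommRing R]

/-- The ring homomorphism `b ⊗ x ⊗ b' ↦ p b * q x * r b'`. -/
noncomputable def lift (p : B →+* R) (q : Γ →+* R) (r : B →+* R) (hL : q.comp H.ηL = p.comp f)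
    (hR : q.comp H.ηR = r.comp f) : H.GammaB f →+* R :=
  RingTensor.lift (RingTensor.lift p q hL.symm) r
    (by rw [← RingHom.comp_assoc, RingTensor.lift_comp_inr, hR])

section

variable (p : B →+* R) (q : Γ →+* R) (r : B →+* R) (hL : q.comp H.ηL = p.comp f)
  (hR : q.comp H.ηR = r.comp f)

@[simp]
theorem lift_left : (lift p q r hL hR).comp (left H f) = p := by
  rw [lift, left, ← RingHom.comp_assoc, RingTensor.lift_comp_inl, RingTensor.lift_comp_inl]

@[simp]
theorem lift_mid : (lift p q r hL hR).comp (mid H f) = q := by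
  rw [lift, mid, ← RingHom.comp_assoc, RingTensor.lift_comp_inl, RingTensor.lift_comp_inr]

@[simp]
theorem lift_right : (lift p q r hL hR).comp (right H f) = r := by
  rw [lift, right, RingTensor.lift_comp_inr]

end

theorem hom_ext {p q : H.GammaB f →+* R} (hl : p.comp (left H f) = q.comp (left H f))
    (hm : p.comp (mid H f) = q.comp (mid H f)) (hr : p.comp (right H f) = q.comp (right H f)) :
    p = q :=
  RingTensor.hom_ext (RingTensor.hom_ext hl hm) hr

variable (H f)

/-- `Δ` on the middle factor: `x ↦ ∑ (1 ⊗ x' ⊗ 1) ⊗ (1 ⊗ x'' ⊗ 1)`. -/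
noncomputable def diagMid : RingTensor H.ηR H.ηL →+* RingTensor (right H f) (left H f) :=
  RingTensor.lift ((RingTensor.inl _ _).comp (mid H f)) ((RingTensor.inr _ _).comp (mid H f))
    (by rw [RingHom.comp_assoc, mid_ηR, ← RingHom.comp_assoc, RingTensor.condition,
      RingHom.comp_assoc, RingHom.comp_assoc, mid_ηL])

/-- `b ⊗ x ⊗ b' ↦ ∑ (b ⊗ x' ⊗ 1) ⊗ (1 ⊗ x'' ⊗ b')`. -/
noncomputable def diag : H.GammaB f →+* RingTensor (right H f) (left H f) :=
  lift ((RingTensor.inl _ _).comp (left H f)) ((diagMid H f).comp H.Δ)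
    ((RingTensor.inr _ _).comp (right H f))
    (by rw [RingHom.comp_assoc, H.Δ_ηL, diagMid, ← RingHom.comp_assoc, RingTensor.lift_comp_inl,
      RingHom.comp_assoc, mid_ηL, RingHom.comp_assoc])
    (by rw [RingHom.comp_assoc, H.Δ_ηR, diagMid, ← RingHom.comp_assoc, RingTensor.lift_comp_inr,
      RingHom.comp_assoc, mid_ηR, RingHom.comp_assoc])

theorem diag_left : (diag H f).comp (left H f) = (RingTensor.inl _ _).comp (left H f) :=
  lift_left ..

theorem diag_right : (diag H f).comp (right H f) = (RingTensor.inr _ _).comp (right H f) :=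
  lift_right ..

theorem diag_mid : (diag H f).comp (mid H f) = (diagMid H f).comp H.Δ :=
  lift_mid ..

theorem lift_comp_diag_left {p q : H.GammaB f →+* R}
    (h : p.comp (right H f) = q.comp (left H f)) :
    ((RingTensor.lift p q h).comp (diag H f)).comp (left H f) = p.comp (left H f) := by
  rw [RingHom.comp_assoc, diag_left, ← RingHom.comp_assoc, RingTensor.lift_comp_inl]

theorem lift_comp_diag_right {p q : H.GammaB f →+* R}
    (h : p.comp (right H f) = q.comp (left H f)) :
    ((RingTensor.lift p q h).comp (diag H f)).comp (right H f) = q.comp (right H f) := by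
  rw [RingHom.comp_assoc, diag_right, ← RingHom.comp_assoc, RingTensor.lift_comp_inr]

theorem lift_mid_condition {p q : H.GammaB f →+* R}
    (h : p.comp (right H f) = q.comp (left H f)) :
    (p.comp (mid H f)).comp H.ηR = (q.comp (mid H f)).comp H.ηL := by
  rw [RingHom.comp_assoc, mid_ηR, ← RingHom.comp_assoc, h, RingHom.comp_assoc, RingHom.comp_assoc,
    mid_ηL]

theorem lift_comp_diag_mid {p q : H.GammaB f →+* R}
    (h : p.comp (right H f) = q.comp (left H f)) :
    ((RingTensor.lift p q h).comp (diag H f)).comp (mid H f) =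
      (RingTensor.lift (p.comp (mid H f)) (q.comp (mid H f))
        (lift_mid_condition H f h)).comp H.Δ := by
  rw [RingHom.comp_assoc, diag_mid, diagMid, ← RingHom.comp_assoc, RingTensor.comp_lift]
  simp only [← RingHom.comp_assoc, RingTensor.lift_comp_inl, RingTensor.lift_comp_inr]

theorem diag_coassoc (i j k : H.GammaB f →+* R) (hij : i.comp (right H f) = j.comp (left H f))
    (hjk : j.comp (right H f) = k.comp (left H f)) :
    (RingTensor.lift ((RingTensor.lift i j hij).comp (diag H f)) k
      (by rw [lift_comp_diag_right, hjk])).comp (diag H f) =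
    (RingTensor.lift i ((RingTensor.lift j k hjk).comp (diag H f))
      (by rw [lift_comp_diag_left, hij])).comp (diag H f) := by
  apply GammaB.hom_ext
  · rw [lift_comp_diag_left, lift_comp_diag_left, lift_comp_diag_left]
  · refine (lift_comp_diag_mid H f _).trans (Eq.trans ?_ (lift_comp_diag_mid H f _).symm)
    refine Eq.trans ?_ ((H.coassoc_points (i.comp (mid H f)) (j.comp (mid H f)) (k.comp (mid H f))
      (lift_mid_condition H f hij) (lift_mid_condition H f hjk)).trans ?_)
    · exact congrArg (fun z => RingHom.comp z H.Δ)
        (RingTensor.lift_congr (lift_comp_diag_mid H f hij) rfl _)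
    · exact congrArg (fun z => RingHom.comp z H.Δ)
        (RingTensor.lift_congr rfl (lift_comp_diag_mid H f hjk).symm _)
  · rw [lift_comp_diag_right, lift_comp_diag_right, lift_comp_diag_right]

/-- `b ⊗ x ⊗ b' ↦ b * f (ε x) * b'`. -/
noncomputable def counit : H.GammaB f →+* B :=
  lift (RingHom.id B) (f.comp H.ε) (RingHom.id B)
    (by rw [RingHom.comp_assoc, H.ε_ηL, RingHom.comp_id, RingHom.id_comp])
    (by rw [RingHom.comp_assoc, H.ε_ηR, RingHom.comp_id, RingHom.id_comp])

theorem counit_left : (counit H f).comp (left H f) = RingHom.id B :=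
  lift_left ..

theorem counit_right : (counit H f).comp (right H f) = RingHom.id B :=
  lift_right ..

theorem counit_mid : (counit H f).comp (mid H f) = f.comp H.ε :=
  lift_mid ..

/-- `b ⊗ x ⊗ b' ↦ b' ⊗ χ x ⊗ b`. -/
noncomputable def conj : H.GammaB f →+* H.GammaB f :=
  lift (right H f) ((mid H f).comp H.χ) (left H f)
    (by rw [RingHom.comp_assoc, H.χ_ηL, mid_ηR])
    (by rw [RingHom.comp_assoc, H.χ_ηR, mid_ηL])

theorem conj_left : (conj H f).comp (left H f) = right H f :=
  lift_left ..

theorem conj_right : (conj H f).comp (right H f) = left H f :=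
  lift_right ..

theorem conj_mid : (conj H f).comp (mid H f) = (mid H f).comp H.χ :=
  lift_mid ..

end GammaB

open GammaB in
/-- The Hopf algebroid `(B, Γ_B)`. -/
noncomputable def baseChange : HopfAlgebroid B (H.GammaB f) where
  ηL := left H f
  ηR := right H f
  ε := GammaB.counit H f
  Δ := diag H f
  χ := conj H f
  ε_ηL := GammaB.counit_left H f
  ε_ηR := GammaB.counit_right H f
  Δ_ηL := diag_left H f
  Δ_ηR := diag_right H f
  χ_ηL := GammaB.conj_left H f
  χ_ηR := GammaB.conj_right H f
  χ_χ := by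
    apply GammaB.hom_ext
    · rw [RingHom.comp_assoc, GammaB.conj_left, GammaB.conj_right, RingHom.id_comp]
    · rw [RingHom.comp_assoc, conj_mid, ← RingHom.comp_assoc, conj_mid, RingHom.comp_assoc, H.χ_χ,
        RingHom.id_comp, RingHom.comp_id]
    · rw [RingHom.comp_assoc, GammaB.conj_right, GammaB.conj_left, RingHom.id_comp]
  counit_left := by
    apply GammaB.hom_ext
    · rw [lift_comp_diag_left, RingHom.comp_assoc, GammaB.counit_left, RingHom.comp_id,
        RingHom.id_comp]
    · have h := congrArg (mid H f).comp H.counit_left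
      rw [← RingHom.comp_assoc, RingTensor.comp_lift] at h
      rw [lift_comp_diag_mid]
      refine Eq.trans ?_ h
      congr 2
      rw [RingHom.comp_assoc, counit_mid, ← RingHom.comp_assoc, ← RingHom.comp_assoc, mid_ηL]
    · rw [lift_comp_diag_right]
  counit_right := by
    apply GammaB.hom_ext
    · rw [lift_comp_diag_left]
    · have h := congrArg (mid H f).comp H.counit_right
      rw [← RingHom.comp_assoc, RingTensor.comp_lift] at h
      rw [lift_comp_diag_mid]
      refine Eq.trans ?_ h
      congr 2
      rw [RingHom.comp_assoc, counit_mid, ← RingHom.comp_assoc, ← RingHom.comp_assoc, mid_ηR]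
    · rw [lift_comp_diag_right, RingHom.comp_assoc, GammaB.counit_right, RingHom.comp_id,
        RingHom.id_comp]
  coassoc := (diag_coassoc H f (RingTensor.inl _ _)
      ((RingTensor.inr _ _).comp (RingTensor.inl _ _))
      ((RingTensor.inr _ _).comp (RingTensor.inr _ _))
      (by rw [RingTensor.condition, RingHom.comp_assoc])
      (by rw [RingHom.comp_assoc, RingTensor.condition, RingHom.comp_assoc])).trans
    (congrArg (fun z => RingHom.comp z (diag H f)) (RingTensor.lift_congr rfl
      (congrArg (fun z => RingHom.comp z (diag H f)) (RingTensor.lift_comp_eta _)) _))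
  conj_right := by
    apply GammaB.hom_ext
    · rw [lift_comp_diag_left, RingHom.comp_assoc, GammaB.counit_left, RingHom.comp_id,
        RingHom.id_comp]
    · have h := congrArg (mid H f).comp H.conj_right
      rw [← RingHom.comp_assoc, RingTensor.comp_lift] at h
      rw [lift_comp_diag_mid, RingHom.comp_assoc, counit_mid, ← RingHom.comp_assoc, ← mid_ηL,
        RingHom.comp_assoc]
      refine Eq.trans ?_ h
      congr 2
      exact conj_mid H f
    · rw [lift_comp_diag_right, RingHom.comp_assoc, GammaB.counit_right, RingHom.comp_id,
        GammaB.conj_right]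
  conj_left := by
    apply GammaB.hom_ext
    · rw [lift_comp_diag_left, RingHom.comp_assoc, GammaB.counit_left, RingHom.comp_id,
        GammaB.conj_left]
    · have h := congrArg (mid H f).comp H.conj_left
      rw [← RingHom.comp_assoc, RingTensor.comp_lift] at h
      rw [lift_comp_diag_mid, RingHom.comp_assoc, counit_mid, ← RingHom.comp_assoc, ← mid_ηR,
        RingHom.comp_assoc]
      refine Eq.trans ?_ h
      congr 2
      exact conj_mid H f
    · rw [lift_comp_diag_right, RingHom.comp_assoc, GammaB.counit_right, RingHom.comp_id,
        RingHom.id_comp]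

/-- The evident map `(A, Γ) → (B, Γ_B)`, given by `f` and `x ↦ 1 ⊗ x ⊗ 1`. -/
noncomputable def toBaseChange : Hom H (H.baseChange f) where
  Φ₀ := f
  Φ₁ := GammaB.mid H f
  map_ηL := GammaB.mid_ηL H f
  map_ηR := GammaB.mid_ηR H f
  map_ε := (GammaB.counit_mid H f).symm
  map_χ := (GammaB.conj_mid H f).symm
  map_Δ := (GammaB.diag_mid H f).symm

end GammaB

/-! ### Landweber exactness and torsion comodules -/

section Landweber

variable {A Γ : Type u} [CommRing A] [CommRing Γ] (H : HopfAlgebroid A Γ)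
  (B : Type u) [CommRing B] [Algebra A B]

/-- `B ⊗[A] -` takes exact sequences of `Γ`-comodules to exact sequences of `B`-modules. (Over a
flat Hopf algebroid, a sequence of comodules is exact iff the underlying one of `A`-modules is.) -/
def IsLandweberExact : Prop :=
  ∀ ⦃M N P : Comod H⦄ (φ : M ⟶ N) (χ : N ⟶ P),
    Function.Exact (Comod.linearMap φ) (Comod.linearMap χ) →
    Function.Exact (BaseChange.map (algebraMap A B) (Comod.linearMap φ))
      (BaseChange.map (algebraMap A B) (Comod.linearMap χ))

/-- The class of comodules `M` with `B ⊗[A] M = 0`. -/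
def torsion : ObjectProperty (Comod H) :=
  fun M => Subsingleton (BaseChange (algebraMap A B) M.carrier)

end Landweber

end HopfAlgebroid

/-- A hereditary torsion theory: a full subcategory closed under subobjects, quotient objects,
extensions, and arbitrary direct sums. -/
structure IsHereditaryTorsionTheory {C : Type (u + 1)} [Category.{u} C] [HasZeroMorphisms C]
    (T : ObjectProperty C) : Prop where
  subobjects : T.IsClosedUnderSubobjects
  quotients : T.IsClosedUnderQuotients
  extensions : T.IsClosedUnderExtensions
  directSums : ∀ ι : Type u, T.IsClosedUnderColimitsOfShape (Discrete ι)

/-- The maps which have a kernel and a cokernel, both of which lie in `T`. -/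
def torsionIso {C : Type (u + 1)} [Category.{u} C] [HasZeroMorphisms C]
    (T : ObjectProperty C) : MorphismProperty C :=
  fun _ _ f => ∃ (k : KernelFork f) (c : CokernelCofork f),
    Nonempty (IsLimit k) ∧ Nonempty (IsColimit c) ∧ T k.pt ∧ T c.pt

/-! ### Exactness of base change along a flat ring homomorphism -/

namespace BaseChange

/-! If a functor has a fully faithful right adjoint, equivalently one for which the counit is
invertible, then it is the localization at the maps that it inverts. So everything comes down to
constructing `Φ^*`, showing that its counit is invertible, and recognizing the maps inverted by
`Φ_*` as those with torsion kernel and cokernel.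

The right adjoint exists for any map of Hopf algebroids `(A, Γ) → (B, S)` with `Γ` flat. A map of
comodules `B ⊗[A] M → N` is an `A`-linear map `g : M → N` compatible with the coactions. The
`A`-linear maps `M → N` are the comodule maps from `M` to the cofree comodule `Γ ⊗[A] N`, and
compatibility says that the composite with a certain map `cofreeDefect` from `Γ ⊗[A] N` to `Γ ⊗[A]
(S ⊗[B] N)` vanishes. Hence `Φ^* N` is the kernel of `cofreeDefect`; flatness of `Γ` puts a coaction
on kernels of comodule maps (`exists_kernel`), and `map_comp_counitHom_bijective` is the universal
property.

For the counit, Landweber exactness makes `B ⊗[A] Φ^* N` the kernel of `B ⊗[A] cofreeDefect`. Since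
`Γ_B = B ⊗[A] Γ ⊗[A] B`, there is an isomorphism `B ⊗[A] (Γ ⊗[A] N) ≅ Γ_B ⊗[B] N`
(`cofreeComparison_bijective`), which turns that map into `1 ⊗ ψ - Δ ⊗ 1`
(`cofreeComparison_map_defect`). The kernel of the latter is `N`, embedded by its coaction, so the
counit is bijective (`counitLinear_bijective`).

Finally, since `B ⊗[A] -` is exact on comodules, it kills the kernel and cokernel of a map exactly
when it inverts the map (`torsionIso_torsion`). Exactness also gives closure of the torsion class
under subobjects, quotients and extensions; closure under direct sums holds because `Φ_*` is a left
adjoint. -/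

theorem map_exact {A S M N P : Type u} [CommRing A] [CommRing S] {f : A →+* S} (hf : f.Flat)
    [AddCommGroup M] [Module A M] [AddCommGroup N] [Module A N] [AddCommGroup P] [Module A P]
    (φ : M →ₗ[A] N) (χ : N →ₗ[A] P) (h : Function.Exact φ χ) :
    Function.Exact (map f φ) (map f χ) := by
  let := f.toAlgebra
  have : Module.Flat A S := hf
  -- Identifies `map` with `lTensor`, so that flatness applies.
  have key {M N : Type u} [AddCommGroup M] [Module A M] [AddCommGroup N] [Module A N]
      (φ : M →ₗ[A] N) (z : BaseChange f M) : map f φ z = φ.lTensor S z := by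
    induction z using induction_on with
    | zero => exact (map_zero _).trans (map_zero (φ.lTensor S)).symm
    | tmul s m => exact map_tmul f φ s m
    | add x y hx hy => rw [map_add, hx, hy]; exact (map_add (φ.lTensor S) _ _).symm
  intro z
  rw [key]
  refine (Module.Flat.lTensor_exact S h z).trans ?_
  simp only [Set.mem_range, key]
  rfl

theorem map_zero_left {A S M N : Type u} [CommRing A] [CommRing S] (f : A →+* S)
    [AddCommGroup M] [Module A M] [AddCommGroup N] [Module A N] :
    map f (0 : M →ₗ[A] N) = 0 := by
  ext z
  induction z using induction_on with
  | zero => simp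
  | tmul s m => simp [tmul_zero]
  | add x y hx hy => rw [map_add, map_add, hx, hy]

/-- Injectivity is exactness of `0 → M → N` at `M`, and base change preserves the zero map. -/
theorem map_injective {A S M N : Type u} [CommRing A] [CommRing S] {f : A →+* S} (hf : f.Flat)
    [AddCommGroup M] [Module A M] [AddCommGroup N] [Module A N] (φ : M →ₗ[A] N)
    (h : Function.Injective φ) : Function.Injective (map f φ) := by
  have e := map_exact hf (0 : M →ₗ[A] M) φ
    ((LinearMap.exact_zero_iff_injective _ _).2 h)
  rw [map_zero_left] at e
  exact (LinearMap.exact_zero_iff_injective _ _).1 e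

end BaseChange

namespace HopfAlgebroid

section Comodule

variable {A Γ : Type u} [CommRing A] [CommRing Γ] (H : HopfAlgebroid A Γ)

/-! ### The maps `ε ⊗ 1` and `Δ ⊗ 1` on `Γ ⊗[A] M` -/

namespace Extended

section

variable {M N : Type u} [AddCommGroup M] [Module A M] [AddCommGroup N] [Module A N]

theorem zero_tmul (m : M) : tmul H 0 m = 0 := by
  simpa using add_tmul H 0 0 m

theorem map_map {P : Type u} [AddCommGroup P] [Module A P] (φ : M →ₗ[A] N) (χ : N →ₗ[A] P)
    (z : H.Extended M) : map H χ (map H φ z) = map H (χ ∘ₗ φ) z :=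
  (LinearMap.congr_fun (map_comp H φ χ) z).symm

theorem counit_map (φ : M →ₗ[A] N) (z : H.Extended M) :
    counit H N (map H φ z) = φ (counit H M z) := by
  induction z using induction_on with
  | zero => simp
  | tmul x m => simp
  | add x y hx hy => simp only [map_add, hx, hy]

theorem tmulRight_map (φ : M →ₗ[A] N) (m : M) (w : RingTensor H.ηR H.ηL) :
    tmulRight H (φ m) w = map H (map H φ) (tmulRight H m w) := by
  induction w using RingTensor.induction_on with
  | zero => simp
  | tmul x y => simp
  | add x y hx hy => simp only [map_add, hx, hy]

theorem comul_map (φ : M →ₗ[A] N) (z : H.Extended M) :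
    comul H N (map H φ z) = map H (map H φ) (comul H M z) := by
  induction z using induction_on with
  | zero => simp
  | tmul x m => simp [tmulRight_map]
  | add x y hx hy => simp only [map_add, hx, hy]

variable (M)

/-- `ε ⊗ 1` as a linear map. -/
noncomputable def counitLinear : H.Extended M →ₗ[A] M :=
  { counit H M with map_smul' := counit_smul H }

/-- `Δ ⊗ 1` as a linear map. -/
noncomputable def comulLinear : H.Extended M →ₗ[A] H.Extended (H.Extended M) :=
  { comul H M with map_smul' := comul_smul H }

variable {M}

@[simp]
theorem counitLinear_apply (z : H.Extended M) : counitLinear H M z = counit H M z :=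
  rfl

@[simp]
theorem comulLinear_apply (z : H.Extended M) : comulLinear H M z = comul H M z :=
  rfl

/-- The left counit axiom tensored with `M`. Together with `map_counit_comul` and `map_comul_comul`
it makes `Γ ⊗[A] M` a comodule. -/
theorem counit_comul (z : H.Extended M) : counit H (H.Extended M) (comul H M z) = z := by
  induction z using induction_on with
  | zero => simp
  | tmul x m =>
    have h := RingHom.congr_fun H.counit_left x
    simp only [RingHom.comp_apply, RingHom.id_apply] at h
    rw [comul_tmul]
    -- Once `x` is written as `(ε ⊗ 1) (Δ x)`, both sides are additive in `Δ x`, which may then be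
    -- replaced by an arbitrary element of `Γ ⊗[A] Γ` and checked on pure tensors.
    conv_rhs => rw [← h]
    generalize H.Δ x = w
    induction w using RingTensor.induction_on with
    | zero => rw [map_zero, map_zero, map_zero, zero_tmul]
    | tmul y z =>
      rw [tmulRight_tmul, counit_tmul, map_mul, RingTensor.lift_inl, RingTensor.lift_inr, smul_def,
        smul_tmul]
      rfl
    | add x y hx hy => rw [map_add, map_add, hx, hy, map_add, add_tmul]
  | add x y hx hy => rw [map_add, map_add, hx, hy]

theorem map_counit_comul (z : H.Extended M) : map H (counitLinear H M) (comul H M z) = z := by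
  induction z using induction_on with
  | zero => simp
  | tmul x m =>
    have h := RingHom.congr_fun H.counit_right x
    simp only [RingHom.comp_apply, RingHom.id_apply] at h
    rw [comul_tmul]
    conv_rhs => rw [← h]
    generalize H.Δ x = w
    induction w using RingTensor.induction_on with
    | zero => rw [map_zero, map_zero, map_zero, zero_tmul]
    | tmul y z =>
      rw [tmulRight_tmul, map_tmul, counitLinear_apply, counit_tmul, map_mul, RingTensor.lift_inl,
        RingTensor.lift_inr, RingHom.comp_apply, RingHom.id_apply, mul_tmul]
    | add x y hx hy => rw [map_add, map_add, hx, hy, map_add, add_tmul]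
  | add x y hx hy => rw [map_add, map_add, hx, hy]

/-- `Γ ⊗[A] (Γ ⊗[A] Γ) → Γ ⊗[A] (Γ ⊗[A] (Γ ⊗[A] M))`, `x ⊗ (y ⊗ z) ↦ x ⊗ (y ⊗ (z ⊗ m))`. -/
noncomputable def tmulRight₂ (m : M) :
    RingTensor H.ηR ((RingTensor.inl H.ηR H.ηL).comp H.ηL) →+
      H.Extended (H.Extended (H.Extended M)) :=
  RingTensor.liftAdd (fun x w => tmul H x (tmulRight H m w)) (fun x y z => add_tmul H x y _)
    (fun x y z => by rw [map_add, tmul_add])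
    (fun x a w => by
      rw [mul_tmul, RingHom.comp_apply, tmulRight_inl_mul, smul_def])

theorem tmulRight₂_tmul (m : M) (x : Γ) (w : RingTensor H.ηR H.ηL) :
    tmulRight₂ H m (RingTensor.inl _ _ x * RingTensor.inr _ _ w) =
      tmul H x (tmulRight H m w) :=
  RingTensor.liftAdd_inl_mul_inr _ _ _ _ x w

/-- Coassociativity of `Δ` is an identity in the ring `Γ ⊗[A] (Γ ⊗[A] Γ)`. Applying `tmulRight₂ H
m`, which appends `m`, turns it into the identity on `x ⊗ m`; each side is then matched by expanding
`Δ x` into pure tensors. -/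
theorem map_comul_comul (z : H.Extended M) :
    map H (comulLinear H M) (comul H M z) = comul H (H.Extended M) (comul H M z) := by
  induction z using induction_on with
  | zero => simp
  | tmul x m =>
    have h := congrArg (tmulRight₂ H m) (RingHom.congr_fun H.coassoc x)
    simp only [RingHom.comp_apply] at h
    rw [comul_tmul]
    refine Eq.trans ?_ (h.symm.trans ?_)
    · generalize H.Δ x = w
      induction w using RingTensor.induction_on with
      | zero => simp
      | tmul y z =>
        rw [tmulRight_tmul, map_tmul, comulLinear_apply, comul_tmul, map_mul, RingTensor.lift_inl,
          RingTensor.lift_inr, RingHom.comp_apply, tmulRight₂_tmul]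
      | add x y hx hy => rw [map_add, map_add, hx, hy, map_add, map_add]
    · generalize H.Δ x = w
      induction w using RingTensor.induction_on with
      | zero => simp
      | tmul y z =>
        rw [tmulRight_tmul, comul_tmul, map_mul, RingTensor.lift_inl, RingTensor.lift_inr,
          RingHom.comp_apply, RingHom.comp_apply]
        generalize H.Δ y = v
        induction v using RingTensor.induction_on with
        | zero => simp
        | tmul p q =>
          rw [map_mul (RingTensor.lift _ _ _), RingTensor.lift_inl, RingTensor.lift_inr,
            RingHom.comp_apply, mul_assoc,
            ← map_mul, tmulRight₂_tmul, tmulRight_tmul, tmulRight_tmul]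
        | add x y hx hy => rw [map_add, add_mul, map_add, hx, hy, map_add]
      | add x y hx hy => rw [map_add, map_add, hx, hy, map_add, map_add]
  | add x y hx hy => rw [map_add, map_add, hx, hy, map_add]

variable {H}

theorem map_exact (hH : H.IsFlat) {P : Type u} [AddCommGroup P] [Module A P]
    (φ : M →ₗ[A] N) (χ : N →ₗ[A] P) (h : Function.Exact φ χ) :
    Function.Exact (map H φ) (map H χ) :=
  BaseChange.map_exact hH φ χ h

theorem map_injective (hH : H.IsFlat) (φ : M →ₗ[A] N) (h : Function.Injective φ) :
    Function.Injective (map H φ) :=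
  BaseChange.map_injective hH φ h

end

end Extended

/-! ### Maps of comodules and their underlying linear maps -/

namespace Comod

variable {H}

theorem linearMap_comp_apply {M N P : Comod H} (f : M ⟶ N) (g : N ⟶ P) (m : M.carrier) :
    linearMap (f ≫ g) m = linearMap g (linearMap f m) :=
  rfl

theorem hom_ext {M N : Comod H} {f g : M ⟶ N} (h : ∀ m, linearMap f m = linearMap g m) : f = g :=
  linearMap_injective _ _ (LinearMap.ext h)

theorem linearMap_comp_eq_zero {M N P : Comod H} {f : M ⟶ N} {g : N ⟶ P} (h : f ≫ g = 0)
    (m : M.carrier) : linearMap g (linearMap f m) = 0 := by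
  rw [← linearMap_comp_apply, h]
  rfl

/-- The linear inverse commutes with the coactions automatically, because every element of `N` has
the form `f m`. -/
theorem isIso_of_bijective {M N : Comod H} (f : M ⟶ N) (h : Function.Bijective (linearMap f)) :
    IsIso f := by
  let e := LinearEquiv.ofBijective (linearMap f) h
  have he (m) : e m = linearMap f m := rfl
  refine ⟨Hom.mk e.symm.toLinearMap fun n => ?_, hom_ext fun m => e.symm_apply_apply m,
    hom_ext fun n => e.apply_symm_apply n⟩
  obtain ⟨m, rfl⟩ := e.surjective n
  rw [LinearEquiv.coe_coe, e.symm_apply_apply, he, ψ_linearMap, Extended.map_map]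
  have : e.symm.toLinearMap ∘ₗ linearMap f = LinearMap.id :=
    LinearMap.ext fun m => e.symm_apply_apply m
  rw [this, Extended.map_id]
  rfl

theorem bijective_of_isIso {M N : Comod H} (f : M ⟶ N) [IsIso f] :
    Function.Bijective (linearMap f) := by
  refine Function.bijective_iff_has_inverse.2 ⟨linearMap (inv f), fun m => ?_, fun n => ?_⟩
  · rw [← linearMap_comp_apply, IsIso.hom_inv_id]
    rfl
  · rw [← linearMap_comp_apply, IsIso.inv_hom_id]
    rfl

/-! ### Cofree comodules -/

variable (H) in
/-- The cofree comodule `Γ ⊗[A] N`. -/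
noncomputable def cofree (N : Type u) [AddCommGroup N] [Module A N] : Comod H where
  carrier := H.Extended N
  ψ := Extended.comulLinear H N
  counit_ψ := Extended.counit_comul H
  coassoc_ψ := Extended.map_comul_comul H

section Cofree

variable {N : Type u} [AddCommGroup N] [Module A N]

/-- The map `M → Γ ⊗[A] N` of comodules corresponding to `g : M → N`. -/
noncomputable def cofreeLift {M : Comod H} (g : M.carrier →ₗ[A] N) : M ⟶ cofree H N :=
  Hom.mk (N := cofree H N) (Extended.map H g ∘ₗ M.ψ) fun m =>
    (Extended.comul_map H g (M.ψ m)).trans <| by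
      rw [← M.coassoc_ψ]
      exact Extended.map_map H _ _ _

/-- The linear map underlying a map to a cofree comodule, with the codomain unfolded. -/
noncomputable def toExtended {M : Comod H} (h : M ⟶ cofree H N) : M.carrier →ₗ[A] H.Extended N :=
  linearMap h

@[simp]
theorem toExtended_cofreeLift {M : Comod H} (g : M.carrier →ₗ[A] N) (m : M.carrier) :
    toExtended (cofreeLift g) m = Extended.map H g (M.ψ m) :=
  rfl

theorem counit_toExtended_cofreeLift {M : Comod H} (g : M.carrier →ₗ[A] N) (m : M.carrier) :
    Extended.counit H N (toExtended (cofreeLift g) m) = g m := by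
  rw [toExtended_cofreeLift, Extended.counit_map, M.counit_ψ]

/-- A comodule map to a cofree comodule is recovered from its composite with `ε ⊗ 1`: it commutes
with the coactions, and `(1 ⊗ ε) Δ = 1`. With `counit_toExtended_cofreeLift` this is the universal
property of cofree comodules. -/
theorem map_counit_toExtended {M : Comod H} (h : M ⟶ cofree H N) (m : M.carrier) :
    Extended.map H (Extended.counitLinear H N ∘ₗ toExtended h) (M.ψ m) = toExtended h m := by
  have e : Extended.comul H N (toExtended h m) = Extended.map H (toExtended h) (M.ψ m) :=
    ψ_linearMap h m
  rw [← Extended.map_map, ← e, Extended.map_counit_comul]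

theorem cofree_hom_ext {M : Comod H} {h k : M ⟶ cofree H N}
    (e : ∀ m, Extended.counit H N (toExtended h m) = Extended.counit H N (toExtended k m)) :
    h = k := by
  refine hom_ext fun m => (map_counit_toExtended h m).symm.trans ?_
  refine Eq.trans ?_ (map_counit_toExtended k m)
  congr 2
  exact LinearMap.ext e

end Cofree

/-! ### Kernels and cokernels -/

section Kernel

/-- The comodule structure on a module embedded in a comodule `M`, provided that the coaction of
`M` restricts to it. -/
noncomputable def ofInjective (hH : H.IsFlat) {L : Type u} [AddCommGroup L] [Module A L]
    (M : Comod H) (ι : L →ₗ[A] M.carrier) (hι : Function.Injective ι)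
    (h : ∀ l, M.ψ (ι l) ∈ LinearMap.range (Extended.map H ι)) : Comod H :=
  -- By flatness `Γ ⊗[A] L` embeds in `Γ ⊗[A] M`, so `ψ (ι l)` has a unique preimage there, which
  -- serves as the coaction of `l`.
  let e := LinearEquiv.ofInjective (Extended.map H ι) (Extended.map_injective hH ι hι)
  let ψ : L →ₗ[A] H.Extended L := e.symm.toLinearMap ∘ₗ (M.ψ ∘ₗ ι).codRestrict _ h
  have hψ (l : L) : Extended.map H ι (ψ l) = M.ψ (ι l) :=
    congrArg Subtype.val (e.apply_symm_apply ((M.ψ ∘ₗ ι).codRestrict _ h l))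
  { carrier := L
    ψ := ψ
    counit_ψ := fun l => hι <| by rw [← Extended.counit_map, hψ, M.counit_ψ]
    coassoc_ψ := fun l => by
      -- Coassociativity is checked after embedding in `Γ ⊗[A] (Γ ⊗[A] M)`, which uses flatness
      -- twice.
      refine Extended.map_injective hH _ (Extended.map_injective hH ι hι) ?_
      have hc : Extended.map H ι ∘ₗ ψ = M.ψ ∘ₗ ι := LinearMap.ext hψ
      rw [Extended.map_map, hc, ← Extended.map_map, hψ, M.coassoc_ψ, ← hψ, Extended.comul_map] }

/-- The embedding of `ofInjective`. -/
noncomputable def ofInjectiveHom (hH : H.IsFlat) {L : Type u} [AddCommGroup L] [Module A L]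
    (M : Comod H) (ι : L →ₗ[A] M.carrier) (hι : Function.Injective ι)
    (h : ∀ l, M.ψ (ι l) ∈ LinearMap.range (Extended.map H ι)) : ofInjective hH M ι hι h ⟶ M :=
  Hom.mk (M := ofInjective hH M ι hι h) ι fun l =>
    (congrArg Subtype.val ((LinearEquiv.ofInjective (Extended.map H ι)
      (Extended.map_injective hH ι hι)).apply_symm_apply
        ((M.ψ ∘ₗ ι).codRestrict _ h l))).symm

variable {M N : Comod H}

theorem mono_of_injective (f : M ⟶ N) (h : Function.Injective (linearMap f)) : Mono f :=
  ⟨fun g k e => hom_ext fun m => h <| by rw [← linearMap_comp_apply, e]; rfl⟩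

/-- By flatness, `Γ ⊗[A] ker f` maps onto the kernel of `1 ⊗ f`, and `1 ⊗ f` kills `ψ l` because `f`
commutes with the coactions. -/
theorem ψ_mem_range_map_ker_subtype (hH : H.IsFlat) (f : M ⟶ N)
    (l : LinearMap.ker (linearMap f)) :
    M.ψ ((LinearMap.ker (linearMap f)).subtype l) ∈
      LinearMap.range (Extended.map H (LinearMap.ker (linearMap f)).subtype) := by
  refine (Extended.map_exact hH _ _ (LinearMap.exact_subtype_ker_map (linearMap f)) _).1 ?_
  rw [← ψ_linearMap, Submodule.subtype_apply, l.2, map_zero]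

/-- The kernel of a map of comodules over a flat Hopf algebroid. -/
theorem exists_kernel (hH : H.IsFlat) (f : M ⟶ N) :
    ∃ (K : Comod H) (i : K ⟶ M), Function.Injective (linearMap i) ∧
      Function.Exact (linearMap i) (linearMap f) :=
  ⟨_, ofInjectiveHom hH M (LinearMap.ker (linearMap f)).subtype (Submodule.subtype_injective _)
    (ψ_mem_range_map_ker_subtype hH f), Submodule.subtype_injective _,
    LinearMap.exact_subtype_ker_map (linearMap f)⟩

/-- A map of comodules factors through an injective one if it does so on underlying modules. -/
theorem exists_lift (hH : H.IsFlat) {K P : Comod H} (i : K ⟶ M)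
    (hi : Function.Injective (linearMap i)) (k : P ⟶ M)
    (hk : ∀ p, linearMap k p ∈ Set.range (linearMap i)) : ∃ l : P ⟶ K, l ≫ i = k := by
  let e := LinearEquiv.ofInjective (linearMap i) hi
  let l : P.carrier →ₗ[A] K.carrier :=
    e.symm.toLinearMap ∘ₗ (linearMap k).codRestrict (LinearMap.range (linearMap i)) hk
  have hl (p) : linearMap i (l p) = linearMap k p :=
    congrArg Subtype.val (e.apply_symm_apply ((linearMap k).codRestrict _ hk p))
  have hc : linearMap i ∘ₗ l = linearMap k := LinearMap.ext hl
  refine ⟨Hom.mk l fun p => Extended.map_injective hH (linearMap i) hi ?_, hom_ext hl⟩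
  rw [← ψ_linearMap, hl, ψ_linearMap, Extended.map_map, hc]

/-- An injective map of comodules with the image of `i` the kernel of `f` is a kernel of `f`. -/
theorem nonempty_isLimit_kernelFork (hH : H.IsFlat) {K : Comod H} (i : K ⟶ M) (f : M ⟶ N)
    (hi : Function.Injective (linearMap i))
    (e : Function.Exact (linearMap i) (linearMap f)) :
    ∃ w : i ≫ f = 0, Nonempty (IsLimit (KernelFork.ofι i w)) := by
  have := mono_of_injective i hi
  refine ⟨hom_ext fun m => (e _).2 ⟨m, rfl⟩, ⟨KernelFork.IsLimit.ofι' i _ fun {P} k hk => ?_⟩⟩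
  have h := exists_lift hH i hi k fun p => (e _).1 (linearMap_comp_eq_zero hk p)
  exact ⟨h.choose, h.choose_spec⟩

/-- The inclusion of the module-theoretic kernel is itself a comodule map, and a monomorphism forces
it to be zero. -/
theorem injective_of_mono (hH : H.IsFlat) (f : M ⟶ N) [Mono f] :
    Function.Injective (linearMap f) := by
  obtain ⟨K, i, -, e⟩ := exists_kernel hH f
  have hi : i = 0 := zero_of_comp_mono f (hom_ext fun m => (e _).2 ⟨m, rfl⟩)
  refine (injective_iff_map_eq_zero _).2 fun m hm => ?_
  obtain ⟨x, rfl⟩ := (e m).1 hm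
  rw [hi]
  rfl

/-- The cokernel of a map of comodules. -/
noncomputable def coker (f : M ⟶ N) : Comod H where
  carrier := N.carrier ⧸ LinearMap.range (linearMap f)
  ψ := (LinearMap.range (linearMap f)).liftQ
    (Extended.map H (LinearMap.range (linearMap f)).mkQ ∘ₗ N.ψ) <| by
      -- The coaction sends `f m` into the image of `1 ⊗ f`, which dies in `Γ ⊗[A] coker f`;
      -- cokernels need no flatness.
      rintro _ ⟨m, rfl⟩
      rw [LinearMap.mem_ker, LinearMap.comp_apply, ψ_linearMap, Extended.map_map,
        LinearMap.range_mkQ_comp]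
      exact LinearMap.congr_fun (map_zero (Extended.mapHom H _ _)) _
  counit_ψ := by
    refine (Submodule.mkQ_surjective _).forall.2 fun n => ?_
    rw [Submodule.mkQ_apply, Submodule.liftQ_apply, LinearMap.comp_apply, Extended.counit_map,
      N.counit_ψ]
    rfl
  coassoc_ψ := by
    refine (Submodule.mkQ_surjective _).forall.2 fun n => ?_
    rw [Submodule.mkQ_apply, Submodule.liftQ_apply, LinearMap.comp_apply, Extended.comul_map,
      ← N.coassoc_ψ, Extended.map_map, Extended.map_map, Submodule.liftQ_mkQ]

/-- The projection to the cokernel. -/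
noncomputable def toCoker (f : M ⟶ N) : N ⟶ coker f :=
  Hom.mk (N := coker f) (LinearMap.range (linearMap f)).mkQ fun _ => rfl

theorem toCoker_surjective (f : M ⟶ N) : Function.Surjective (linearMap (toCoker f)) :=
  Submodule.mkQ_surjective _

theorem exact_toCoker (f : M ⟶ N) : Function.Exact (linearMap f) (linearMap (toCoker f)) :=
  LinearMap.exact_map_mkQ_range (linearMap f)

theorem comp_toCoker (f : M ⟶ N) : f ≫ toCoker f = 0 :=
  hom_ext fun m => (exact_toCoker f _).2 ⟨m, rfl⟩

/-- A map which vanishes on the image of `f` factors through the cokernel of `f`. -/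
theorem exists_desc (f : M ⟶ N) {P : Comod H} (k : N ⟶ P) (hk : f ≫ k = 0) :
    ∃ d : coker f ⟶ P, toCoker f ≫ d = k := by
  obtain ⟨d, hd⟩ : ∃ d : (coker f).carrier →ₗ[A] P.carrier,
      ∀ n, d (linearMap (toCoker f) n) = linearMap k n :=
    ⟨(LinearMap.range (linearMap f)).liftQ (linearMap k) (by
      rintro _ ⟨m, rfl⟩
      exact linearMap_comp_eq_zero hk m), fun n => rfl⟩
  have hc : d ∘ₗ linearMap (toCoker f) = linearMap k := LinearMap.ext hd
  refine ⟨Hom.mk d ((toCoker_surjective f).forall.2 fun n => ?_), hom_ext hd⟩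
  rw [hd, ψ_linearMap, ψ_linearMap, Extended.map_map, hc]

theorem surjective_of_epi (f : M ⟶ N) [Epi f] : Function.Surjective (linearMap f) := by
  have h : toCoker f = 0 := zero_of_epi_comp f (comp_toCoker f)
  refine fun n => (exact_toCoker f n).1 ?_
  rw [h]
  rfl

theorem epi_of_surjective (f : M ⟶ N) (h : Function.Surjective (linearMap f)) : Epi f :=
  ⟨fun g k e => hom_ext <| h.forall.2 fun m => by
    rw [← linearMap_comp_apply, e]; rfl⟩

/-- `toCoker f` is a cokernel of `f`. -/
noncomputable def isColimitToCoker (f : M ⟶ N) :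
    IsColimit (CokernelCofork.ofπ (toCoker f) (comp_toCoker f)) :=
  have := epi_of_surjective _ (toCoker_surjective f)
  CokernelCofork.IsColimit.ofπ' _ _ fun k hk =>
    ⟨(exists_desc f k hk).choose, (exists_desc f k hk).choose_spec⟩

/-- A map through which all maps killed by `f` factor is exact at the source of `f`. -/
theorem exact_of_lift (hH : H.IsFlat) {L : Comod H} (i : L ⟶ M) (f : M ⟶ N) (w : i ≫ f = 0)
    (h : ∀ {P : Comod H} (k : P ⟶ M), k ≫ f = 0 → ∃ l : P ⟶ L, l ≫ i = k) :
    Function.Exact (linearMap i) (linearMap f) := by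
  obtain ⟨K, k, -, e⟩ := exists_kernel hH f
  obtain ⟨l, rfl⟩ := h k (hom_ext fun m => (e _).2 ⟨m, rfl⟩)
  refine fun m => ⟨fun hm => ?_, ?_⟩
  · obtain ⟨x, rfl⟩ := (e m).1 hm
    exact ⟨linearMap l x, rfl⟩
  · rintro ⟨x, rfl⟩
    exact linearMap_comp_eq_zero w x

/-- If `g` kills `m`, then so does the projection to `coker f`, which factors through `g`; hence `m`
lies in the image of `f`. -/
theorem exact_of_desc {L : Comod H} (f : L ⟶ M) (g : M ⟶ N) (w : f ≫ g = 0)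
    (h : ∃ d : N ⟶ coker f, g ≫ d = toCoker f) :
    Function.Exact (linearMap f) (linearMap g) := by
  obtain ⟨d, hd⟩ := h
  refine fun m => ⟨fun hm => (exact_toCoker f m).1 ?_, ?_⟩
  · rw [← hd, linearMap_comp_apply, hm, map_zero]
  · rintro ⟨x, rfl⟩
    exact linearMap_comp_eq_zero w x

/-- Needed to read off from a short exact sequence that its second map is a cokernel of the first.
-/
theorem balanced (hH : H.IsFlat) : Balanced (Comod H) :=
  ⟨fun f _ _ => isIso_of_bijective f ⟨injective_of_mono hH f, surjective_of_epi f⟩⟩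

end Kernel

end Comod
end Comodule
end HopfAlgebroid

/-! ### Restriction of scalars -/

/-- A module over `S`, regarded as a module over `A` through `f : A →+* S`. -/
def Restrict {A S : Type u} [CommRing A] [CommRing S] (_f : A →+* S) (N : Type u) : Type u :=
  N

namespace Restrict

variable {A S : Type u} [CommRing A] [CommRing S] (f : A →+* S)
  (N : Type u) [AddCommGroup N] [Module S N] {M : Type u} [AddCommGroup M] [Module A M]

instance : AddCommGroup (Restrict f N) :=
  inferInstanceAs (AddCommGroup N)

noncomputable instance : Module A (Restrict f N) :=
  Module.compHom N f

/-- The identity map `Restrict f N → N`. -/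
def out : Restrict f N →ₛₗ[f] N where
  toFun n := n
  map_add' _ _ := rfl
  map_smul' _ _ := rfl

theorem out_bijective : Function.Bijective (out f N) :=
  Function.bijective_id

variable {f N}

variable (f) in
/-- The identity map `N → Restrict f N`. -/
def of : N →+ Restrict f N where
  toFun n := n
  map_zero' := rfl
  map_add' _ _ := rfl

@[simp]
theorem out_of (n : N) : out f N (of f n) = n :=
  rfl

theorem of_smul (a : A) (n : N) : of f (f a • n) = a • of f n :=
  rfl

/-- A semilinear map as a linear map to the restriction. -/
def lift (g : M →ₛₗ[f] N) : M →ₗ[A] Restrict f N where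
  toFun := g
  map_add' := g.map_add
  map_smul' := g.map_smulₛₗ

@[simp]
theorem out_lift (g : M →ₛₗ[f] N) (m : M) : out f N (lift g m) = g m :=
  rfl

end Restrict

namespace HopfAlgebroid

namespace Hom

variable {A Γ B S : Type u} [CommRing A] [CommRing Γ] [CommRing B] [CommRing S]
  {H : HopfAlgebroid A Γ} {K : HopfAlgebroid B S} (Φ : Hom H K)

/-! ### The right adjoint `Φ^*` -/

section

variable (N : Type u) [AddCommGroup N] [Module B N]

/-- `Γ ⊗[A] N → S ⊗[B] N`, `x ⊗ n ↦ Φ₁ x ⊗ n`, for a `B`-module `N`. -/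
noncomputable def extendedRestrict : H.Extended (Restrict Φ.Φ₀ N) →ₛₗ[Φ.Φ₀] K.Extended N :=
  let g : H.Extended (Restrict Φ.Φ₀ N) →+ K.Extended N :=
    Extended.liftAdd H (fun x n => Extended.tmul K (Φ.Φ₁ x) (Restrict.out Φ.Φ₀ N n))
      (fun x y n => by rw [map_add, Extended.add_tmul])
      (fun x m n => by rw [map_add, Extended.tmul_add])
      (fun x a n => by
        have h := RingHom.congr_fun Φ.map_ηR a
        simp only [RingHom.comp_apply] at h
        rw [map_mul, h, Extended.mul_tmul, LinearMap.map_smulₛₗ])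
  { g with
    map_smul' := fun a z => by
      have h := RingHom.congr_fun Φ.map_ηL a
      simp only [RingHom.comp_apply] at h
      change g (a • z) = Φ.Φ₀ a • g z
      induction z using Extended.induction_on with
      | zero => simp
      | tmul x n =>
        rw [Extended.smul_def, Extended.smul_tmul, Extended.smul_def, ← h]
        simp only [g, Extended.liftAdd_tmul]
        rw [map_mul, Extended.smul_tmul]
      | add x y hx hy => rw [smul_add, map_add, map_add, hx, hy, smul_add] }

variable {N}

@[simp]
theorem extendedRestrict_tmul (x : Γ) (n : Restrict Φ.Φ₀ N) :
    Φ.extendedRestrict N (Extended.tmul H x n) =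
      Extended.tmul K (Φ.Φ₁ x) (Restrict.out Φ.Φ₀ N n) :=
  rfl

theorem extendedRestrict_map {P : Type u} [AddCommGroup P] [Module B P] (χ : N →ₗ[B] P)
    (z : H.Extended (Restrict Φ.Φ₀ N)) :
    Φ.extendedRestrict P (Extended.map H (Restrict.lift (χ.comp (Restrict.out Φ.Φ₀ N))) z) =
      Extended.map K χ (Φ.extendedRestrict N z) := by
  induction z using Extended.induction_on with
  | zero => simp
  | tmul x m => simp
  | add x y hx hy => simp only [map_add, hx, hy]

/-- This is `(Φ₁ ⊗ Φ₁) Δ = Δ Φ₁`, tensored with `N`. -/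
theorem extendedRestrict_comul (z : H.Extended (Restrict Φ.Φ₀ N)) :
    Φ.extendedRestrict (K.Extended N)
        (Extended.map H (Restrict.lift (Φ.extendedRestrict N)) (Extended.comul H _ z)) =
      Extended.comul K N (Φ.extendedRestrict N z) := by
  induction z using Extended.induction_on with
  | zero => simp
  | tmul x n =>
    have h := RingHom.congr_fun Φ.map_Δ x
    simp only [RingHom.comp_apply] at h
    rw [Extended.comul_tmul, extendedRestrict_tmul, Extended.comul_tmul, ← h]
    generalize H.Δ x = w
    induction w using RingTensor.induction_on with
    | zero => simp
    | tmul y z => simp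
    | add x y hx hy => simp only [map_add, hx, hy]
  | add x y hx hy => simp only [map_add, hx, hy]

theorem counit_extendedRestrict (z : H.Extended (Restrict Φ.Φ₀ N)) :
    Extended.counit K N (Φ.extendedRestrict N z) =
      Restrict.out Φ.Φ₀ N (Extended.counit H _ z) := by
  induction z using Extended.induction_on with
  | zero => simp
  | tmul x n =>
    have h := RingHom.congr_fun Φ.map_ε x
    simp only [RingHom.comp_apply] at h
    rw [extendedRestrict_tmul, Extended.counit_tmul, Extended.counit_tmul, LinearMap.map_smulₛₗ, h]
  | add x y hx hy => simp only [map_add, hx, hy]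

/-- Both sides send `x ⊗ m` to `Φ₁ x ⊗ g m`. This translates the condition that a map out of `B ⊗[A]
M` respects coactions into one on `1 ⊗ g`. -/
theorem map_lift_extendedMap {M : Type u} [AddCommGroup M] [Module A M]
    (g : M →ₗ[A] Restrict Φ.Φ₀ N) (z : H.Extended M) :
    Extended.map K (BaseChange.lift Φ.Φ₀ ((Restrict.out Φ.Φ₀ N).comp g)) (Φ.extendedMap M z) =
      Φ.extendedRestrict N (Extended.map H g z) := by
  induction z using Extended.induction_on with
  | zero => simp
  | tmul x m => simp
  | add x y hx hy => simp only [map_add, hx, hy]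

end

section

variable (N : Comod K)

/-- The difference of the maps `x ⊗ n ↦ ψ (ε x • n)` and `x ⊗ n ↦ Φ₁ x ⊗ n` from `Γ ⊗[A] N`
to `S ⊗[B] N`. -/
noncomputable def defect :
    H.Extended (Restrict Φ.Φ₀ N.carrier) →ₗ[A] Restrict Φ.Φ₀ (K.Extended N.carrier) :=
  Restrict.lift (N.ψ.comp (Restrict.out Φ.Φ₀ N.carrier)) ∘ₗ Extended.counitLinear H _ -
    Restrict.lift (Φ.extendedRestrict N.carrier)

theorem out_defect (z : H.Extended (Restrict Φ.Φ₀ N.carrier)) :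
    Restrict.out _ _ (Φ.defect N z) =
      N.ψ (Restrict.out _ _ (Extended.counit H _ z)) - Φ.extendedRestrict N.carrier z :=
  rfl

/-- The left side is `cofreeDefect` followed by the passage from `Γ` to `S`. In the first term of
`defect` the factor `ε` cancels against `Δ`, leaving `1 ⊗ ψ`; the second term becomes `Δ ⊗ 1`. -/
theorem extendedRestrict_map_defect (z : H.Extended (Restrict Φ.Φ₀ N.carrier)) :
    Φ.extendedRestrict _ (Extended.map H (Φ.defect N) (Extended.comul H _ z)) =
      Extended.map K N.ψ (Φ.extendedRestrict _ z) - Extended.comul K _ (Φ.extendedRestrict _ z) := by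
  have h (w) : Extended.map H (Φ.defect N) w =
      Extended.map H (Restrict.lift (N.ψ.comp (Restrict.out Φ.Φ₀ N.carrier)))
          (Extended.map H (Extended.counitLinear H _) w) -
        Extended.map H (Restrict.lift (Φ.extendedRestrict N.carrier)) w := by
    rw [Extended.map_map]
    exact LinearMap.congr_fun (map_sub (Extended.mapHom H _ _) _ _) w
  rw [h, map_sub, Extended.map_counit_comul, extendedRestrict_map, extendedRestrict_comul]

/-- The map of cofree `Γ`-comodules whose kernel is `Φ^* N`. -/
noncomputable def cofreeDefect : Comod.cofree H (Restrict Φ.Φ₀ N.carrier) ⟶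
    Comod.cofree H (Restrict Φ.Φ₀ (K.Extended N.carrier)) :=
  Comod.cofreeLift (M := Comod.cofree H (Restrict Φ.Φ₀ N.carrier)) (Φ.defect N)

/-- A map to a cofree comodule vanishes as soon as its composite with `ε ⊗ 1` does, and for `h ≫
cofreeDefect` that composite is `defect` applied to `h`. -/
theorem comp_cofreeDefect_eq_zero_iff {M : Comod H}
    (h : M ⟶ Comod.cofree H (Restrict Φ.Φ₀ N.carrier)) :
    h ≫ Φ.cofreeDefect N = 0 ↔ ∀ m,
      N.ψ (Restrict.out _ _ (Extended.counit H _ (Comod.toExtended h m))) =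
        Φ.extendedRestrict N.carrier (Comod.toExtended h m) := by
  have key (m) : Extended.counit H _ (Comod.toExtended (h ≫ Φ.cofreeDefect N) m) =
      Φ.defect N (Comod.toExtended h m) :=
    Comod.counit_toExtended_cofreeLift (M := Comod.cofree H (Restrict Φ.Φ₀ N.carrier))
      (Φ.defect N) (Comod.linearMap h m)
  constructor
  · intro e m
    rw [← sub_eq_zero, ← out_defect, ← key, e]
    exact (congrArg _ (map_zero _)).trans (map_zero _)
  · intro e
    refine Comod.cofree_hom_ext fun m => (key m).trans ?_
    refine Eq.trans ((Restrict.out_bijective _ _).1 ?_) (map_zero (Extended.counit H _)).symm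
    rw [out_defect, e, sub_self, map_zero]

variable (hH : H.IsFlat)

/-- The comodule `Φ^* N`. -/
noncomputable def pullbackObj : Comod H :=
  (Comod.exists_kernel hH (Φ.cofreeDefect N)).choose

/-- The inclusion of `Φ^* N` in `Γ ⊗[A] N`. -/
noncomputable def pullbackι :
    Φ.pullbackObj N hH ⟶ Comod.cofree H (Restrict Φ.Φ₀ N.carrier) :=
  (Comod.exists_kernel hH (Φ.cofreeDefect N)).choose_spec.choose

theorem pullbackι_injective : Function.Injective (Comod.linearMap (Φ.pullbackι N hH)) :=
  (Comod.exists_kernel hH (Φ.cofreeDefect N)).choose_spec.choose_spec.1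

theorem exact_pullbackι : Function.Exact (Comod.linearMap (Φ.pullbackι N hH))
    (Comod.linearMap (Φ.cofreeDefect N)) :=
  (Comod.exists_kernel hH (Φ.cofreeDefect N)).choose_spec.choose_spec.2

theorem pullbackι_comp_cofreeDefect : Φ.pullbackι N hH ≫ Φ.cofreeDefect N = 0 :=
  Comod.hom_ext fun m => (Φ.exact_pullbackι N hH _).2 ⟨m, rfl⟩

/-- The linear map underlying the counit `Φ_* Φ^* N → N`. -/
noncomputable def counitLinear :
    BaseChange Φ.Φ₀ (Φ.pullbackObj N hH).carrier →ₗ[B] N.carrier :=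
  BaseChange.lift Φ.Φ₀ ((Restrict.out Φ.Φ₀ N.carrier).comp
    (Extended.counitLinear H _ ∘ₗ Comod.toExtended (Φ.pullbackι N hH)))

theorem counitLinear_tmul (b : B) (m : (Φ.pullbackObj N hH).carrier) :
    Φ.counitLinear N hH (BaseChange.tmul _ b m) =
      b • Restrict.out _ _ (Extended.counit H _ (Comod.toExtended (Φ.pullbackι N hH) m)) :=
  rfl

theorem ψ_counitLinear (z : BaseChange Φ.Φ₀ (Φ.pullbackObj N hH).carrier) :
    N.ψ (Φ.counitLinear N hH z) =
      Extended.map K (Φ.counitLinear N hH) (Φ.coaction (Φ.pullbackObj N hH) z) := by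
  induction z using BaseChange.induction_on with
  | zero => simp
  | tmul b m =>
    rw [counitLinear_tmul, coaction_tmul, map_smul, map_smul, counitLinear, map_lift_extendedMap,
      Comod.map_counit_toExtended]
    congr 1
    exact (Φ.comp_cofreeDefect_eq_zero_iff N _).1 (Φ.pullbackι_comp_cofreeDefect N hH) m
  | add x y hx hy => simp only [map_add, hx, hy]

/-- The counit `Φ_* Φ^* N → N`. -/
noncomputable def counitHom : Φ.pushforward.obj (Φ.pullbackObj N hH) ⟶ N :=
  Comod.Hom.mk (M := Φ.pushforwardObj (Φ.pullbackObj N hH)) (Φ.counitLinear N hH)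
    (Φ.ψ_counitLinear N hH)

theorem linearMap_map_comp_counitHom_tmul {M : Comod H} (l : M ⟶ Φ.pullbackObj N hH) (b : B)
    (m : M.carrier) :
    Comod.linearMap (Φ.pushforward.map l ≫ Φ.counitHom N hH) (BaseChange.tmul Φ.Φ₀ b m) =
      b • Restrict.out _ _
        (Extended.counit H _ (Comod.toExtended (l ≫ Φ.pullbackι N hH) m)) := by
  refine (congrArg (Φ.counitLinear N hH) (BaseChange.map_tmul Φ.Φ₀ (Comod.linearMap l) b m)).trans
    ?_
  rw [counitLinear_tmul]
  rfl

/-- The universal property of `Φ^* N`. Only flatness of `Γ` is needed, not the form of `S` or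
exactness of `B ⊗[A] -`. -/
theorem map_comp_counitHom_bijective (M : Comod H) :
    Function.Bijective fun l : M ⟶ Φ.pullbackObj N hH =>
      Φ.pushforward.map l ≫ Φ.counitHom N hH := by
  have := Comod.mono_of_injective _ (Φ.pullbackι_injective N hH)
  constructor
  · intro l l' e
    -- In the cofree comodule it suffices to compare composites with `ε ⊗ 1`, and these are the
    -- values of the two maps on the tensors `1 ⊗ m`.
    rw [← cancel_mono (Φ.pullbackι N hH)]
    refine Comod.cofree_hom_ext fun m => (Restrict.out_bijective _ _).1 ?_
    have h := congrArg (fun k => Comod.linearMap k (BaseChange.tmul Φ.Φ₀ 1 m)) e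
    simpa only [linearMap_map_comp_counitHom_tmul, one_smul] using h
  · intro f
    let F : BaseChange Φ.Φ₀ M.carrier →ₗ[B] N.carrier := Comod.linearMap f
    have hF (z) : N.ψ (F z) = Extended.map K F (Φ.coaction M z) := Comod.ψ_linearMap f z
    let g : M.carrier →ₗ[A] Restrict Φ.Φ₀ N.carrier := Restrict.lift
      { toFun := fun m => F (BaseChange.tmul Φ.Φ₀ 1 m)
        map_add' := fun m n => by rw [BaseChange.tmul_add, map_add]
        map_smul' := fun a m => by
          rw [← BaseChange.mul_tmul, ← map_smul, BaseChange.smul_tmul, one_mul, mul_one] }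
    have hg (m) : Restrict.out _ _ (g m) = F (BaseChange.tmul Φ.Φ₀ 1 m) := rfl
    have hgF : BaseChange.lift Φ.Φ₀ ((Restrict.out Φ.Φ₀ N.carrier).comp g) = F := by
      ext z
      induction z using BaseChange.induction_on with
      | zero => simp
      | tmul b m =>
        rw [BaseChange.lift_tmul, LinearMap.comp_apply, hg, ← map_smul, BaseChange.smul_tmul,
          mul_one]
      | add x y hx hy => rw [map_add, map_add, hx, hy]
    -- That `F` respects the coactions, evaluated at `1 ⊗ m`, is exactly the condition for
    -- `cofreeLift g` to land in the kernel `Φ^* N`.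
    have h0 : Comod.cofreeLift g ≫ Φ.cofreeDefect N = 0 := by
      refine (Φ.comp_cofreeDefect_eq_zero_iff N _).2 fun m => ?_
      rw [Comod.counit_toExtended_cofreeLift, hg, hF, coaction_tmul, one_smul,
        Comod.toExtended_cofreeLift, ← map_lift_extendedMap, hgF]
    obtain ⟨l, hl⟩ := Comod.exists_lift hH _ (Φ.pullbackι_injective N hH) (Comod.cofreeLift g)
      fun m => (Φ.exact_pullbackι N hH _).1 (Comod.linearMap_comp_eq_zero h0 m)
    refine ⟨l, Comod.hom_ext fun z => ?_⟩
    induction z using BaseChange.induction_on with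
    | zero => exact (map_zero _).trans (map_zero _).symm
    | tmul b m =>
      rw [linearMap_map_comp_counitHom_tmul, hl, Comod.counit_toExtended_cofreeLift, hg,
        ← map_smul, BaseChange.smul_tmul, mul_one]
      rfl
    | add x y hx hy =>
      exact (map_add _ x y).trans ((congrArg₂ _ hx hy).trans (map_add _ x y).symm)

end

section

variable (hH : H.IsFlat)

/-- The bijection between maps `Φ_* M → N` and maps `M → Φ^* N`. -/
noncomputable def pullbackHomEquiv (M : Comod H) (N : Comod K) :
    (Φ.pushforward.obj M ⟶ N) ≃ (M ⟶ Φ.pullbackObj N hH) :=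
  (Equiv.ofBijective _ (Φ.map_comp_counitHom_bijective N hH M)).symm

theorem pullbackHomEquiv_symm_apply {M : Comod H} {N : Comod K} (l : M ⟶ Φ.pullbackObj N hH) :
    (Φ.pullbackHomEquiv hH M N).symm l = Φ.pushforward.map l ≫ Φ.counitHom N hH :=
  rfl

theorem pullbackHomEquiv_naturality (M' M : Comod H) (N : Comod K) (f : M' ⟶ M)
    (g : Φ.pushforward.obj M ⟶ N) :
    Φ.pullbackHomEquiv hH M' N (Φ.pushforward.map f ≫ g) = f ≫ Φ.pullbackHomEquiv hH M N g := by
  rw [← Equiv.eq_symm_apply, pullbackHomEquiv_symm_apply, Functor.map_comp, Category.assoc,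
    ← pullbackHomEquiv_symm_apply, Equiv.symm_apply_apply]

/-- The functor `Φ^* : S-comod ⥤ Γ-comod`. -/
noncomputable def pullback : Comod K ⥤ Comod H :=
  Adjunction.rightAdjointOfEquiv (Φ.pullbackHomEquiv hH) (Φ.pullbackHomEquiv_naturality hH)

/-- `Φ_*` is left adjoint to `Φ^*`. -/
noncomputable def pullbackAdjunction : Φ.pushforward ⊣ Φ.pullback hH :=
  Adjunction.adjunctionOfEquivRight _ _

theorem pullbackAdjunction_counit_app (N : Comod K) :
    (Φ.pullbackAdjunction hH).counit.app N = Φ.counitHom N hH := by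
  rw [pullbackAdjunction, Adjunction.adjunctionOfEquivRight_counit_app,
    pullbackHomEquiv_symm_apply]
  exact (congrArg (· ≫ _) (Φ.pushforward.map_id _)).trans (Category.id_comp _)

end

end Hom

end HopfAlgebroid

/-! ### The counit and the comparison of cofree comodules -/

namespace HopfAlgebroid

namespace Hom

variable {A Γ B S : Type u} [CommRing A] [CommRing Γ] [CommRing B] [CommRing S]
  {H : HopfAlgebroid A Γ} {K : HopfAlgebroid B S} (Φ : Hom H K)

/-- `B ⊗[A] (Γ ⊗[A] N) → S ⊗[B] N`, `b ⊗ (x ⊗ n) ↦ ηL b * Φ₁ x ⊗ n`. -/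
noncomputable def cofreeComparison (N : Type u) [AddCommGroup N] [Module B N] :
    BaseChange Φ.Φ₀ (H.Extended (Restrict Φ.Φ₀ N)) →ₗ[B] K.Extended N :=
  BaseChange.lift Φ.Φ₀ (Φ.extendedRestrict N)

theorem cofreeComparison_tmul {N : Type u} [AddCommGroup N] [Module B N] (b : B)
    (z : H.Extended (Restrict Φ.Φ₀ N)) :
    Φ.cofreeComparison N (BaseChange.tmul _ b z) = b • Φ.extendedRestrict N z :=
  rfl

variable (N : Comod K)

/-- The `B`-linear extension of `extendedRestrict_map_defect`: `cofreeComparison` carries `B ⊗[A]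
cofreeDefect` to `1 ⊗ ψ - Δ ⊗ 1`. -/
theorem cofreeComparison_map_defect
    (z : BaseChange Φ.Φ₀ (H.Extended (Restrict Φ.Φ₀ N.carrier))) :
    Φ.cofreeComparison _
        (BaseChange.map Φ.Φ₀ (Extended.map H (Φ.defect N) ∘ₗ Extended.comulLinear H _) z) =
      Extended.map K N.ψ (Φ.cofreeComparison _ z) -
        Extended.comul K _ (Φ.cofreeComparison _ z) := by
  induction z using BaseChange.induction_on with
  | zero => simp
  | tmul b z =>
    rw [BaseChange.map_tmul, cofreeComparison_tmul, cofreeComparison_tmul, LinearMap.comp_apply,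
      Extended.comulLinear_apply, extendedRestrict_map_defect, smul_sub, map_smul,
      Extended.comul_smul]
  | add x y hx hy =>
    simp only [map_add, hx, hy]
    abel

/-- Expresses the counit through the embedding of `B ⊗[A] Φ^* N` in `S ⊗[B] N`, where `ε ⊗ 1` is a
left inverse of the coaction of `N`. -/
theorem counitLinear_eq (hH : H.IsFlat) (z : BaseChange Φ.Φ₀ (Φ.pullbackObj N hH).carrier) :
    Φ.counitLinear N hH z = Extended.counit K _ (Φ.cofreeComparison _
      (BaseChange.map Φ.Φ₀ (Comod.toExtended (Φ.pullbackι N hH)) z)) := by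
  induction z using BaseChange.induction_on with
  | zero => simp
  | tmul b z =>
    rw [BaseChange.map_tmul, cofreeComparison_tmul, Extended.counit_smul, counitLinear_tmul,
      counit_extendedRestrict]
  | add x y hx hy => simp only [map_add, hx, hy]

/-- The coaction of a comodule `N` identifies it with the equalizer of `1 ⊗ ψ` and `Δ ⊗ 1`. -/
theorem _root_.HopfAlgebroid.Comod.eq_ψ_counit (N : Comod K) (z : K.Extended N.carrier)
    (h : Extended.map K N.ψ z = Extended.comul K _ z) :
    z = N.ψ (Extended.counit K _ z) := by
  rw [← Extended.counit_map, h, Extended.counit_comul]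

/-- The counit of the adjunction is bijective if `B ⊗[A] -` is exact on comodules and commutes
with forming cofree comodules. -/
theorem counitLinear_bijective (hH : H.IsFlat)
    (hθ : ∀ (P : Type u) [AddCommGroup P] [Module B P],
      Function.Bijective (Φ.cofreeComparison P))
    (hΦ : ∀ ⦃L M N : Comod H⦄ (φ : L ⟶ M) (χ : M ⟶ N),
      Function.Exact (Comod.linearMap φ) (Comod.linearMap χ) →
      Function.Exact (BaseChange.map Φ.Φ₀ (Comod.linearMap φ))
        (BaseChange.map Φ.Φ₀ (Comod.linearMap χ))) :
    Function.Bijective (Φ.counitLinear N hH) := by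
  have e : Function.Exact (BaseChange.map Φ.Φ₀ (Comod.toExtended (Φ.pullbackι N hH)))
      (BaseChange.map Φ.Φ₀ (Extended.map H (Φ.defect N) ∘ₗ Extended.comulLinear H _)) :=
    hΦ (Φ.pullbackι N hH) (Φ.cofreeDefect N) (Φ.exact_pullbackι N hH)
  have hi : Function.Injective
      (BaseChange.map Φ.Φ₀ (Comod.toExtended (Φ.pullbackι N hH))) := by
    have e' := hΦ (0 : Φ.pullbackObj N hH ⟶ Φ.pullbackObj N hH) (Φ.pullbackι N hH)
      ((LinearMap.exact_zero_iff_injective _ _).2 (Φ.pullbackι_injective N hH))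
    rw [Comod.linearMap_zero, BaseChange.map_zero_left] at e'
    exact (LinearMap.exact_zero_iff_injective _ _).1 e'
  constructor
  · refine (injective_iff_map_eq_zero _).2 fun z hz => ?_
    -- The image `w` of `z` in `S ⊗[B] N` equalizes `1 ⊗ ψ` and `Δ ⊗ 1`, so `w` is `ψ` of the image
    -- of `z` under the counit, which is zero.
    have h := Φ.cofreeComparison_map_defect N
      (BaseChange.map Φ.Φ₀ (Comod.toExtended (Φ.pullbackι N hH)) z)
    rw [(e _).2 ⟨z, rfl⟩, map_zero] at h
    have h' := N.eq_ψ_counit _ (sub_eq_zero.1 h.symm)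
    rw [← counitLinear_eq, hz, map_zero] at h'
    exact (map_eq_zero_iff _ hi).1 ((map_eq_zero_iff _ (hθ _).1).1 h')
  · intro n
    -- By coassociativity, the element `y` corresponding to `ψ n` is killed by `B ⊗[A]
    -- cofreeDefect`, so it comes from `B ⊗[A] Φ^* N`; then `ε ⊗ 1` recovers `n`.
    obtain ⟨y, hy⟩ := (hθ _).2 (N.ψ n)
    have h := Φ.cofreeComparison_map_defect N y
    rw [hy, N.coassoc_ψ, sub_self] at h
    obtain ⟨z, rfl⟩ := (e y).1 ((map_eq_zero_iff _ (hθ _).1).1 h)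
    exact ⟨z, by rw [counitLinear_eq, hy, N.counit_ψ]⟩

end Hom

/-! ### Cofree comodules over `Γ` and over `Γ_B` -/

section GammaB

variable {A Γ B : Type u} [CommRing A] [CommRing Γ] [CommRing B] (H : HopfAlgebroid A Γ)
  (f : A →+* B) {N : Type u} [AddCommGroup N] [Module B N]

namespace GammaB

/-- `b ⊗ x ↦ b ⊗ (x ⊗ n)` -/
noncomputable def tmulMid (n : Restrict f N) :
    RingTensor f H.ηL →+ BaseChange f (H.Extended (Restrict f N)) :=
  RingTensor.liftAdd (fun b x => BaseChange.tmul f b (Extended.tmul H x n))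
    (fun b b' x => BaseChange.add_tmul f b b' _)
    (fun b x x' => by rw [Extended.add_tmul, BaseChange.tmul_add])
    (fun b a x => by rw [BaseChange.mul_tmul, Extended.smul_def, Extended.smul_tmul])

@[simp]
theorem tmulMid_tmul (n : Restrict f N) (b : B) (x : Γ) :
    tmulMid H f n (RingTensor.inl _ _ b * RingTensor.inr _ _ x) =
      BaseChange.tmul f b (Extended.tmul H x n) :=
  RingTensor.liftAdd_inl_mul_inr _ _ _ _ b x

theorem tmulMid_add (n n' : Restrict f N) (w : RingTensor f H.ηL) :
    tmulMid H f (n + n') w = tmulMid H f n w + tmulMid H f n' w := by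
  induction w using RingTensor.induction_on with
  | zero => simp
  | tmul b x => simp [Extended.tmul_add, BaseChange.tmul_add]
  | add x y hx hy => rw [map_add, map_add, map_add, hx, hy]; abel

theorem tmulMid_mul_inr (n : Restrict f N) (a : A) (w : RingTensor f H.ηL) :
    tmulMid H f n (w * RingTensor.inr _ _ (H.ηR a)) = tmulMid H f (a • n) w := by
  induction w using RingTensor.induction_on with
  | zero => simp
  | tmul b x => rw [mul_assoc, ← map_mul, tmulMid_tmul, tmulMid_tmul, Extended.mul_tmul]
  | add x y hx hy => rw [add_mul, map_add, map_add, hx, hy]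

/-- `b ⊗ x ⊗ b' ↦ b ⊗ (x ⊗ b' n)` -/
noncomputable def tmulLeft (n : N) : H.GammaB f →+ BaseChange f (H.Extended (Restrict f N)) :=
  RingTensor.liftAdd (fun w b => tmulMid H f (Restrict.of f (b • n)) w)
    (fun w w' b => map_add _ w w')
    (fun w b b' => by rw [add_smul, map_add, tmulMid_add])
    (fun w a b => by rw [RingHom.comp_apply, tmulMid_mul_inr, mul_smul, Restrict.of_smul])

@[simp]
theorem tmulLeft_tmul (n : N) (w : RingTensor f H.ηL) (b : B) :
    tmulLeft H f n (RingTensor.inl _ _ w * RingTensor.inr _ _ b) =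
      tmulMid H f (Restrict.of f (b • n)) w :=
  RingTensor.liftAdd_inl_mul_inr _ _ _ _ w b

theorem tmulLeft_add (n n' : N) (w : H.GammaB f) :
    tmulLeft H f (n + n') w = tmulLeft H f n w + tmulLeft H f n' w := by
  induction w using RingTensor.induction_on with
  | zero => simp
  | tmul w b => simp [tmulMid_add]
  | add x y hx hy => rw [map_add, map_add, map_add, hx, hy]; abel

theorem tmulLeft_mul_right (n : N) (b : B) (w : H.GammaB f) :
    tmulLeft H f n (w * right H f b) = tmulLeft H f (b • n) w := by
  induction w using RingTensor.induction_on with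
  | zero => simp
  | tmul w b' => rw [right, mul_assoc, ← map_mul, tmulLeft_tmul, tmulLeft_tmul, mul_smul]
  | add x y hx hy => rw [add_mul, map_add, map_add, hx, hy]

variable (N) in
/-- `(b ⊗ x ⊗ b') ⊗ n ↦ b ⊗ (x ⊗ b' n)`, the inverse of `Hom.cofreeComparison`. -/
noncomputable def cofreeComparisonInv :
    (H.baseChange f).Extended N →+ BaseChange f (H.Extended (Restrict f N)) :=
  Extended.liftAdd (H.baseChange f) (fun s n => tmulLeft H f n s) (fun s t _ => map_add _ s t)
    (fun s n n' => tmulLeft_add H f n n' s) (fun s b n => tmulLeft_mul_right H f n b s)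

theorem cofreeComparisonInv_tmul (s : H.GammaB f) (n : N) :
    cofreeComparisonInv H f N (Extended.tmul (H.baseChange f) s n) = tmulLeft H f n s :=
  rfl

end GammaB

open GammaB

theorem cofreeComparison_tmul_tmul (b : B) (x : Γ) (n : Restrict f N) :
    (H.toBaseChange f).cofreeComparison N (BaseChange.tmul f b (Extended.tmul H x n)) =
      Extended.tmul (H.baseChange f) (left H f b * mid H f x) (Restrict.out f N n) :=
  rfl

/-- This is `(B ⊗[A] Γ ⊗[A] B) ⊗[B] N ≅ B ⊗[A] (Γ ⊗[A] N)`, the one place where the form of `Γ_B`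
matters; neither flatness nor exactness is involved. -/
theorem cofreeComparison_bijective (N : Type u) [AddCommGroup N] [Module B N] :
    Function.Bijective ((H.toBaseChange f).cofreeComparison N) := by
  refine Function.bijective_iff_has_inverse.2 ⟨cofreeComparisonInv H f N, fun z => ?_, fun z => ?_⟩
  · change cofreeComparisonInv H f N _ = (z : BaseChange f (H.Extended (Restrict f N)))
    induction z using BaseChange.induction_on with
    | zero => exact (congrArg _ (map_zero _)).trans (map_zero _)
    | tmul b z =>
      induction z using Extended.induction_on with
      | zero => rw [BaseChange.tmul_zero]; exact (congrArg _ (map_zero _)).trans (map_zero _)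
      | tmul x n =>
        refine (congrArg _ (cofreeComparison_tmul_tmul H f b x n)).trans ?_
        rw [cofreeComparisonInv_tmul]
        -- Exhibits the element as a pure tensor `b ⊗ x ⊗ 1`, the shape on which `tmulLeft` is
        -- computed.
        have h : left H f b * mid H f x = RingTensor.inl _ _
            (RingTensor.inl _ _ b * RingTensor.inr _ _ x) * RingTensor.inr _ _ 1 := by
          rw [map_one, mul_one, map_mul]
          rfl
        rw [h, tmulLeft_tmul, tmulMid_tmul, one_smul]
        rfl
      | add x y hx hy =>
        rw [BaseChange.tmul_add]
        exact (congrArg _ (map_add _ _ _)).trans ((map_add _ _ _).trans (congrArg₂ _ hx hy))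
    | add x y hx hy =>
      exact (congrArg _ (map_add _ x y)).trans ((map_add _ _ _).trans (congrArg₂ _ hx hy))
  · induction z using Extended.induction_on with
    | zero => exact (congrArg _ (map_zero _)).trans (map_zero _)
    | tmul s n =>
      rw [cofreeComparisonInv_tmul]
      induction s using RingTensor.induction_on with
      | zero =>
        rw [map_zero, Extended.zero_tmul]
        exact map_zero _
      | tmul w b' =>
        rw [tmulLeft_tmul]
        induction w using RingTensor.induction_on with
        | zero =>
          rw [map_zero, map_zero, zero_mul, Extended.zero_tmul]
          exact map_zero _
        | tmul b x =>
          rw [tmulMid_tmul]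
          refine (cofreeComparison_tmul_tmul H f b x _).trans ?_
          rw [Restrict.out_of, map_mul]
          -- The third factor `b'` of `Γ_B` moves across the tensor product over `B`.
          exact (Extended.mul_tmul (H.baseChange f) _ b' n).symm
        | add x y hx hy =>
          rw [map_add, map_add, add_mul, Extended.add_tmul, ← hx, ← hy]
          exact map_add _ _ _
      | add x y hx hy =>
        rw [map_add, Extended.add_tmul, ← hx, ← hy]
        exact map_add _ _ _
    | add x y hx hy =>
      exact (congrArg _ (map_add _ x y)).trans ((map_add _ _ _).trans (congrArg₂ _ hx hy))

end GammaB

/-! ### Invertibility of the counit in the Landweber exact case -/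

section Landweber

variable {A Γ : Type u} [CommRing A] [CommRing Γ] {H : HopfAlgebroid A Γ}
  {B : Type u} [CommRing B] [Algebra A B]

theorem isIso_counit_pullbackAdjunction (hH : H.IsFlat) (hB : H.IsLandweberExact B) :
    IsIso ((H.toBaseChange (algebraMap A B)).pullbackAdjunction hH).counit := by
  refine @NatIso.isIso_of_isIso_app _ _ _ _ _ _ _ fun N => ?_
  rw [Hom.pullbackAdjunction_counit_app]
  exact Comod.isIso_of_bijective _ ((H.toBaseChange (algebraMap A B)).counitLinear_bijective N hH
    (cofreeComparison_bijective H _) hB)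

/-- Right adjoints are unique up to an isomorphism compatible with the counits, so the constructed
one decides. -/
theorem isIso_counit (hH : H.IsFlat) (hB : H.IsLandweberExact B)
    (G : (H.baseChange (algebraMap A B)).Comod ⥤ H.Comod)
    (adj : (H.toBaseChange (algebraMap A B)).pushforward ⊣ G) : IsIso adj.counit := by
  have := isIso_counit_pullbackAdjunction hH hB
  refine @NatIso.isIso_of_isIso_app _ _ _ _ _ _ _ fun N => ?_
  rw [← Adjunction.rightAdjointUniq_hom_app_counit adj
    ((H.toBaseChange (algebraMap A B)).pullbackAdjunction hH)]
  infer_instance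

/-! ### The torsion theory -/

/-- A categorical form of torsion, suited to computing with colimits. -/
theorem torsion_iff_id_eq_zero (M : Comod H) : H.torsion B M ↔
    𝟙 ((H.toBaseChange (algebraMap A B)).pushforward.obj M) = 0 := by
  constructor
  · intro h
    exact Comod.hom_ext fun z => h.elim _ _
  · intro h
    have h' (z : BaseChange (algebraMap A B) M.carrier) : z = 0 :=
      LinearMap.congr_fun (congrArg Comod.linearMap h) z
    exact ⟨fun x y => (h' x).trans (h' y).symm⟩

theorem baseChange_map_injective (hB : H.IsLandweberExact B) {M N : Comod H} (φ : M ⟶ N)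
    (h : Function.Injective (Comod.linearMap φ)) :
    Function.Injective (BaseChange.map (algebraMap A B) (Comod.linearMap φ)) := by
  have e := hB (0 : M ⟶ M) φ ((LinearMap.exact_zero_iff_injective _ _).2 h)
  rw [Comod.linearMap_zero, BaseChange.map_zero_left] at e
  exact (LinearMap.exact_zero_iff_injective _ _).1 e

theorem baseChange_map_surjective (hB : H.IsLandweberExact B) {M N : Comod H} (φ : M ⟶ N)
    (h : Function.Surjective (Comod.linearMap φ)) :
    Function.Surjective (BaseChange.map (algebraMap A B) (Comod.linearMap φ)) := by
  have e := hB φ (0 : N ⟶ N) ((LinearMap.exact_zero_iff_surjective _ _).2 h)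
  rw [Comod.linearMap_zero, BaseChange.map_zero_left] at e
  exact (LinearMap.exact_zero_iff_surjective _ _).1 e

theorem torsion_of_exact (hB : H.IsLandweberExact B) {L M N : Comod H} (φ : L ⟶ M) (χ : M ⟶ N)
    (e : Function.Exact (Comod.linearMap φ) (Comod.linearMap χ)) (hL : H.torsion B L)
    (hN : H.torsion B N) : H.torsion B M := by
  have h (z : BaseChange (algebraMap A B) M.carrier) : z = 0 := by
    obtain ⟨y, rfl⟩ := (hB φ χ e z).1 (hN.elim _ _)
    rw [hL.elim y 0, map_zero]
  exact ⟨fun x y => (h x).trans (h y).symm⟩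

theorem isHereditaryTorsionTheory_torsion (hH : H.IsFlat) (hB : H.IsLandweberExact B) :
    IsHereditaryTorsionTheory (H.torsion B) where
  subobjects := ⟨fun f _ hY => by
    have : Subsingleton (BaseChange (algebraMap A B) _) := hY
    exact (baseChange_map_injective hB f (Comod.injective_of_mono hH f)).subsingleton⟩
  quotients := ⟨fun f _ hX => by
    have : Subsingleton (BaseChange (algebraMap A B) _) := hX
    exact (baseChange_map_surjective hB f (Comod.surjective_of_epi f)).subsingleton⟩
  extensions := ⟨fun {S} hS h₁ h₃ => by
    -- The categorical short exact sequence is turned into one of modules: the projection to the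
    -- cokernel of the first map factors through the second.
    have := Comod.balanced hH
    have := hS.epi_g
    exact torsion_of_exact hB _ _ (Comod.exact_of_desc _ _ S.zero
      ⟨hS.exact.desc _ (Comod.comp_toCoker _), hS.exact.g_desc _ _⟩) h₁ h₃⟩
  directSums ι := ⟨by
    rintro X ⟨c⟩
    -- As a left adjoint, `Φ_*` sends the direct sum to a colimit of zero objects, so the identity
    -- of that colimit vanishes on each summand.
    have := ((H.toBaseChange (algebraMap A B)).pullbackAdjunction hH).leftAdjoint_preservesColimits
    rw [torsion_iff_id_eq_zero]
    refine (isColimitOfPreserves (H.toBaseChange (algebraMap A B)).pushforward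
      c.isColimit).hom_ext fun j => ?_
    have h : 𝟙 ((c.diag ⋙ (H.toBaseChange (algebraMap A B)).pushforward).obj j) = 0 :=
      (torsion_iff_id_eq_zero _).1 (c.prop_diag_obj j)
    rw [← cancel_epi (𝟙 _), h, zero_comp, zero_comp]⟩

/-- By exactness, `B ⊗[A] -` takes the kernel and cokernel of `f` to those of `B ⊗[A] f`, and a
comodule map is invertible if and only if it is bijective. -/
theorem torsionIso_torsion (hH : H.IsFlat) (hB : H.IsLandweberExact B) :
    torsionIso (H.torsion B) = (MorphismProperty.isomorphisms _).inverseImage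
      (H.toBaseChange (algebraMap A B)).pushforward := by
  ext M N f
  rw [MorphismProperty.inverseImage_iff, MorphismProperty.isomorphisms.iff]
  constructor
  · rintro ⟨k, c, ⟨hk⟩, ⟨hc⟩, hTk, hTc⟩
    have ek := hB _ _ (Comod.exact_of_lift hH k.ι f k.condition fun i hi =>
      ⟨_, (KernelFork.IsLimit.lift' hk i hi).2⟩)
    have ec := hB _ _ (Comod.exact_of_desc f c.π c.condition
      ⟨_, (CokernelCofork.IsColimit.desc' hc _ (Comod.comp_toCoker f)).2⟩)
    refine Comod.isIso_of_bijective _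
      ⟨(injective_iff_map_eq_zero (BaseChange.map (algebraMap A B) (Comod.linearMap f))).2
        fun z hz => ?_, fun z => (ec z).1 (hTc.elim _ _)⟩
    obtain ⟨y, rfl⟩ := (ek z).1 hz
    rw [hTk.elim y 0, map_zero]
  · intro h
    have hb : Function.Bijective (BaseChange.map (algebraMap A B) (Comod.linearMap f)) :=
      Comod.bijective_of_isIso ((H.toBaseChange (algebraMap A B)).pushforward.map f)
    obtain ⟨K, i, hi, e⟩ := Comod.exists_kernel hH f
    obtain ⟨w, hl⟩ := Comod.nonempty_isLimit_kernelFork hH i f hi e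
    refine ⟨_, _, hl, ⟨Comod.isColimitToCoker f⟩, ?_, ?_⟩
    -- `B ⊗[A] K` embeds in `B ⊗[A] N` through `B ⊗[A] i` followed by the injective `B ⊗[A] f`, yet
    -- this composite is zero.
    · refine ⟨fun x y => baseChange_map_injective hB i hi (hb.1 ?_)⟩
      have h0 (x) := (hB i f e _).2 ⟨x, rfl⟩
      rw [h0, h0]
    -- Elements of `B ⊗[A] coker f` lift to `B ⊗[A] N`, hence to `B ⊗[A] M` as `B ⊗[A] f` is
    -- surjective, and so they vanish.
    · refine ⟨(baseChange_map_surjective hB _ (Comod.toCoker_surjective f)).forall₂.2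
        fun x y => ?_⟩
      have h0 (x) := (hB f (Comod.toCoker f) (Comod.exact_toCoker f) x).2 (hb.2 x)
      rw [h0, h0]

end Landweber

end HopfAlgebroid

theorem mainTheorem6 {A Γ : Type u} [CommRing A] [CommRing Γ] (H : HopfAlgebroid A Γ)
    (hH : H.IsFlat) (B : Type u) [CommRing B] [Algebra A B] (hB : H.IsLandweberExact B) :
    -- the comodules `M` with `B ⊗[A] M = 0` form a hereditary torsion theory
    IsHereditaryTorsionTheory (H.torsion B) ∧
    -- `Φ_*` induces an equivalence from the localization at this torsion theory
    (∃ h : (torsionIso (H.torsion B)).IsInvertedBy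
        (H.toBaseChange (algebraMap A B)).pushforward,
      (Localization.Construction.lift
        (H.toBaseChange (algebraMap A B)).pushforward h).IsEquivalence) ∧
    -- `Φ_*` has a right adjoint `Φ^*`, and the counit `Φ_* Φ^* ⟶ 1` is an isomorphism
    (H.toBaseChange (algebraMap A B)).pushforward.IsLeftAdjoint ∧
    ∀ (G : (H.baseChange (algebraMap A B)).Comod ⥤ H.Comod)
      (adj : (H.toBaseChange (algebraMap A B)).pushforward ⊣ G), IsIso adj.counit := by
  have hloc : (H.toBaseChange (algebraMap A B)).pushforward.IsLocalization
      (torsionIso (H.torsion B)) := by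
    have := HopfAlgebroid.isIso_counit_pullbackAdjunction hH hB
    -- An invertible counit makes `Φ^*` fully faithful, so `Φ_*` is a localization at the maps that
    -- it inverts; these are the maps in `torsionIso`.
    have hff :=
      ((H.toBaseChange (algebraMap A B)).pullbackAdjunction hH).fullyFaithfulROfIsIsoCounit
    have := hff.faithful
    have := hff.full
    rw [HopfAlgebroid.torsionIso_torsion hH hB]
    exact ((H.toBaseChange (algebraMap A B)).pullbackAdjunction hH).isLocalization
  exact ⟨HopfAlgebroid.isHereditaryTorsionTheory_torsion hH hB,
    ⟨hloc.inverts, hloc.isEquivalence⟩,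
    ((H.toBaseChange (algebraMap A B)).pullbackAdjunction hH).isLeftAdjoint,
    HopfAlgebroid.isIso_counit hH hB⟩
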